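/- Let $G$ be a finitely generated group. For a subgroup $H\le G$, a subset of $G$ is called $H$-finite if it is contained in the union of finitely many right cosets $Hg$. Let $\mathcal{P}G$ be the $\mathbb{F}_2$-vector space of all subsets of $G$ (with symmetric difference as addition), on which $G$ acts by right translation, and let $\mathcal{F}_HG$ be the subspace of $H$-finite subsets. The number of relative ends of the pair $(G,H)$ (Kropholler–Roller) is $\widetilde{e}(G,H)=\dim_{\mathbb{F}_2}(\mathcal{P}G/\mathcal{F}_HG)^G\in\{0,1,2,\dots,\infty\}$, and the number of ends of a group $\Gamma$ is $e(\Gamma)=\widetilde{e}(\Gamma,\{1\})$. The subgroup $H$ is almost malnormal in $G$ if, for every $g\in G$, $gHg^{-1}\cap H$ infinite implies $g\in H$. The group $G$ splits over a subgroup $K$ if either $G$ is an amalgamated free product $A*_KB$ of subgroups $A,B\le G$ with $A\neq K\neq B$, or $G$ is an HNN extension $A*_K$ with base group $A\le G$ and $K$ as one of the two associated subgroups. **Theorem.** Let $G$ be a finitely generated group and let $H$ be a finitely generated subgroup of $G$ such that $e(G)=e(H)=1$ and $\widetilde{e}(G,H)\geq 2$. If $H$ is almost malnormal in $G$, then there is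 a subgroup $K$ of $H$ such that $G$ splits over $K$. -/

import Mathlib

open scoped Pointwise

/-- A subset `X` of `G` is `H`-finite if it is contained in the union `HS` of finitely many right
cosets `Hs`, `s ∈ S`, of `H` in `G`. -/
def IsHFinite {G : Type*} [Group G] (H : Subgroup G) (X : Set G) : Prop :=
  ∃ S : Set G, S.Finite ∧ X ⊆ (H : Set G) * S

theorem IsHFinite.union {G : Type*} [Group G] {H : Subgroup G} {X Y : Set G}
    (hX : IsHFinite H X) (hY : IsHFinite H Y) : IsHFinite H (X ∪ Y) := by
  obtain ⟨S, hS, hXS⟩ := hX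
  obtain ⟨T, hT, hYT⟩ := hY
  refine ⟨S ∪ T, hS.union hT, ?_⟩
  rw [Set.mul_union]
  exact Set.union_subset_union hXS hYT

theorem IsHFinite.mono {G : Type*} [Group G] {H : Subgroup G} {X Y : Set G}
    (hY : IsHFinite H Y) (h : X ⊆ Y) : IsHFinite H X := by
  obtain ⟨S, hS, hYS⟩ := hY
  exact ⟨S, hS, h.trans hYS⟩

/-- The `𝔽₂`-vector space of subsets of `G` (a subset being identified with its indicator function
`G → ZMod 2`, so that addition is symmetric difference) contains the subspace of `H`-finite
subsets. -/
def hFiniteSets {G : Type*} [Group G] (H : Subgroup G) : Submodule (ZMod 2) (G → ZMod 2) where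
  carrier := {f | IsHFinite H (Function.support f)}
  zero_mem' := ⟨∅, Set.finite_empty, by simp⟩
  add_mem' := fun {f g} hf hg => (IsHFinite.union hf hg).mono (Function.support_add f g)
  smul_mem' := fun c f hf => IsHFinite.mono hf (Function.support_const_smul_subset c f)

/-- The subsets `X` of `G` such that `X` and `Xg` are `H`-almost equal (their symmetric difference
is `H`-finite) for all `g` in `G`. It is not required that `HX = X`. -/
def almostInvariantSets {G : Type*} [Group G] (H : Subgroup G) :
    Submodule (ZMod 2) (G → ZMod 2) where
  carrier := {f | ∀ g : G, (fun x => f (x * g)) - f ∈ hFiniteSets H}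
  zero_mem' := fun g => by
    have h : (fun x : G => (0 : G → ZMod 2) (x * g)) - 0 = 0 := by ext x; simp
    rw [h]
    exact Submodule.zero_mem _
  add_mem' := fun {a b} ha hb g => by
    have h : (fun x : G => (a + b) (x * g)) - (a + b) =
        ((fun x => a (x * g)) - a) + ((fun x => b (x * g)) - b) := by
      ext x
      simp only [Pi.sub_apply, Pi.add_apply]
      ring
    rw [h]
    exact Submodule.add_mem _ (ha g) (hb g)
  smul_mem' := fun c a ha g => by
    have h : (fun x : G => (c • a) (x * g)) - c • a = c • ((fun x => a (x * g)) - a) := by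
      ext x
      simp only [Pi.sub_apply, Pi.smul_apply, smul_eq_mul]
      ring
    rw [h]
    exact Submodule.smul_mem _ c (ha g)

/-- `H`-finite subsets are stable under right translation, so that
`almostInvariantSets H / hFiniteSets H` is the space of `G`-invariants in the quotient of the space
of all subsets of `G` by the `H`-finite ones. -/
theorem hFiniteSets_le_almostInvariantSets {G : Type*} [Group G] (H : Subgroup G) :
    hFiniteSets H ≤ almostInvariantSets H := by
  intro f hf g
  refine Submodule.sub_mem _ ?_ hf
  obtain ⟨S, hS, hfS⟩ := hf
  refine ⟨S * {g⁻¹}, hS.mul (Set.finite_singleton _), fun x hx => ?_⟩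
  obtain ⟨h, hh, s, hs, hxs⟩ := hfS (show x * g ∈ Function.support f from hx)
  refine ⟨h, hh, s * g⁻¹, ⟨s, hs, g⁻¹, rfl, rfl⟩, ?_⟩
  simp only at hxs ⊢
  rw [← mul_assoc, hxs, mul_inv_cancel_right]

/-- The number `ẽ(G, H)` of relative ends of the pair `(G, H)` in the sense of Kropholler and
Roller: the dimension over `𝔽₂` of the space of `G`-invariants `(𝒫G / 𝓕_H G)^G`, where `𝒫G` is the
space of all subsets of `G` and `𝓕_H G` is the subspace of `H`-finite subsets; it is a natural
number or `∞`. -/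
noncomputable def relativeEnds {G : Type*} [Group G] (H : Subgroup G) : ℕ∞ :=
  Cardinal.toENat (Module.rank (ZMod 2)
    (almostInvariantSets H ⧸ (hFiniteSets H).submoduleOf (almostInvariantSets H)))

/-- The number `e(G)` of ends of the group `G`: the dimension over `𝔽₂` of `(𝒫G / 𝓕G)^G`, where
`𝓕G` is the space of finite subsets of `G`, which are the subsets that are finite relative to the
trivial subgroup. -/
noncomputable def numEnds (G : Type*) [Group G] : ℕ∞ :=
  relativeEnds (⊥ : Subgroup G)

/-- `H` is almost malnormal in `G`: whenever `gHg⁻¹ ∩ H` is infinite, `g` lies in `H`. -/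
def AlmostMalnormal {G : Type*} [Group G] (H : Subgroup G) : Prop :=
  ∀ g : G, (((MulAut.conj g • H) ⊓ H : Subgroup G) : Set G).Infinite → g ∈ H

/-- `G` is the amalgamated free product `P₀ *_C P₁` of two subgroups that both contain `C`
properly: the natural homomorphism from the amalgam to `G` is an isomorphism. -/
def IsNontrivialAmalgamOver {G : Type*} [Group G] (C : Subgroup G) : Prop :=
  ∃ (P : Fin 2 → Subgroup G) (hC : ∀ i, C < P i),
    Function.Bijective
      (Monoid.PushoutI.lift (φ := fun i => Subgroup.inclusion (hC i).le)
        (fun i => (P i).subtype) C.subtype (fun _ => rfl))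

/-- `G` is an HNN extension `A *_C`, with base group `A`, associated subgroups `C` and `B` of `A`
and stable letter `t`: the natural homomorphism from the HNN extension to `G` is an isomorphism. -/
def IsHNNExtensionOver {G : Type*} [Group G] (C : Subgroup G) : Prop :=
  ∃ (A : Subgroup G) (_ : C ≤ A) (B : Subgroup A) (φ : C.subgroupOf A ≃* B) (t : G)
    (ht : ∀ a : C.subgroupOf A, t * A.subtype (a : A) = A.subtype (φ a : A) * t),
    Function.Bijective (HNNExtension.lift A.subtype t ht)

/-- `G` splits over its subgroup `C`: either `G = P₀ *_C P₁` with `P₀ ≠ C ≠ P₁`, or `G = A *_C`. -/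
def SplitsOver {G : Type*} [Group G] (C : Subgroup G) : Prop :=
  IsNontrivialAmalgamOver C ∨ IsHNNExtensionOver C

/-! The aim is a set `Y` whose translates `gY` are nested, so that they are the oriented edges of a
tree on which `G` acts. The splitting is then over the stabilizer of `Y`, which turns out to lie in
`H`.

Since `ẽ(G, H) ≥ 2`, there is an `H`-almost invariant `X` such that neither `X` nor its complement
is `H`-finite. Deleting from a Cayley graph an `H`-finite set containing `H` and the coboundary of
`X` leaves a component `C` inside `X` that is not `H`-finite. The `H`-translates of `C` are equal or
disjoint, and `C` is almost invariant even relative to its stabilizer `K` in `H`. By almost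
malnormality a coset `gH` with `g ∉ H` meets each `H`-finite set in a finite set, so `C` traces on
it an almost invariant subset of `H`. As `e(H) = 1`, almost all of `gH` lies in `C` or almost all
lies outside. Let `Y` be the union of the cosets mostly inside `C`. It differs from `C` by a
`K`-finite set (`isHFinite_cosetsInside_symmDiff`), and `YH = Y`.

For `g ∉ H`, choose `U` and `V` among `Y` and its complement with `g ∉ U` and `g⁻¹ ∉ V`. Almost
malnormality makes the coboundary of the corner `U ∩ gV` finite, so `e(G) = 1` makes the corner
finite or cofinite. It is a union of cosets of the infinite group `H` and misses `g`, hence is empty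
(`AlmostMalnormal.inter_smul_eq_empty`). This is nestedness for `g ∉ H`; for `g ∈ H` it comes from
the translates of `C`.

The structure theorem for the action (`splitsOver_stabilizer`) is proved directly: injectivity by
ping-pong with the sets `gY`, surjectivity by connectedness of the dual tree. -/

/-- The points `x` at which membership in `X` changes under right translation by `g`. -/
def flipSet {G : Type*} [Group G] (X : Set G) (g : G) : Set G := {x | ¬ (x ∈ X ↔ x * g ∈ X)}

/-- `X` is `H`-almost equal to each of its right translates. -/
def IsAlmostInvariant {G : Type*} [Group G] (H : Subgroup G) (X : Set G) : Prop :=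
  ∀ g : G, IsHFinite H (flipSet X g)

theorem support_indicator_one {G : Type*} (X : Set G) :
    Function.support (X.indicator (1 : G → ZMod 2)) = X := by
  ext x; simp

theorem eq_indicator_support {G : Type*} (f : G → ZMod 2) :
    f = (Function.support f).indicator 1 := by
  ext x
  by_cases h : f x = 0
  · simp [h]
  · have : f x = 1 := by
      generalize f x = a at h
      revert h; revert a; decide
    simp [this]

theorem indicator_compl_eq {G : Type*} (X : Set G) :
    (Xᶜ).indicator (1 : G → ZMod 2) = (Set.univ).indicator 1 - X.indicator 1 := by
  ext x
  by_cases h1 : x ∈ X <;> simp [h1]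

/-! ### Almost invariant sets and what the numbers of ends say about them -/

section basics

variable {G : Type*} [Group G] {H K : Subgroup G} {X Y : Set G}

theorem flipSet_compl (X : Set G) (g : G) : flipSet Xᶜ g = flipSet X g := by
  ext x; simp only [flipSet, Set.mem_ofPred_eq, Set.mem_compl_iff]; tauto

theorem IsAlmostInvariant.compl (h : IsAlmostInvariant H X) : IsAlmostInvariant H Xᶜ := fun g => by
  rw [flipSet_compl]; exact h g

theorem IsHFinite.of_le (h : K ≤ H) (hX : IsHFinite K X) : IsHFinite H X := by
  obtain ⟨S, hS, hXS⟩ := hX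
  exact ⟨S, hS, hXS.trans (Set.mul_subset_mul_right h)⟩

theorem IsHFinite.of_finite (hX : X.Finite) : IsHFinite H X :=
  ⟨X, hX, fun x hx => ⟨1, H.one_mem, x, hx, one_mul x⟩⟩

theorem IsHFinite.subgroup_mul (hX : IsHFinite H X) : IsHFinite H ((H : Set G) * X) := by
  obtain ⟨S, hS, hXS⟩ := hX
  refine ⟨S, hS, ?_⟩
  calc (H : Set G) * X ⊆ H * (H * S) := Set.mul_subset_mul_left hXS
    _ = H * S := by rw [← mul_assoc, coe_mul_coe]

theorem IsHFinite.mul_finite (hX : IsHFinite H X) (hY : Y.Finite) : IsHFinite H (X * Y) := by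
  obtain ⟨S, hS, hXS⟩ := hX
  refine ⟨S * Y, hS.mul hY, ?_⟩
  rw [← mul_assoc]
  exact Set.mul_subset_mul_right hXS

theorem IsHFinite.biUnion {ι : Type*} {I : Set ι} (hI : I.Finite) {f : ι → Set G}
    (hf : ∀ i ∈ I, IsHFinite H (f i)) : IsHFinite H (⋃ i ∈ I, f i) := by
  choose! S hS hfS using hf
  refine ⟨⋃ i ∈ I, S i, hI.biUnion hS, Set.iUnion₂_subset fun i hi => (hfS i hi).trans ?_⟩
  exact Set.mul_subset_mul_left (Set.subset_biUnion_of_mem hi)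

theorem isHFinite_bot_iff : IsHFinite (⊥ : Subgroup G) X ↔ X.Finite := by
  refine ⟨fun ⟨S, hS, h⟩ => hS.subset (h.trans ?_), IsHFinite.of_finite⟩
  simp

theorem IsHFinite.finite (hX : IsHFinite H X) (hH : (H : Set G).Finite) : X.Finite := by
  obtain ⟨S, hS, hXS⟩ := hX
  exact (hH.mul hS).subset hXS

theorem indicator_mem_hFiniteSets :
    X.indicator (1 : G → ZMod 2) ∈ hFiniteSets H ↔ IsHFinite H X := by
  change IsHFinite H (Function.support (X.indicator (1 : G → ZMod 2))) ↔ _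
  rw [support_indicator_one]

theorem indicator_mem_almostInvariantSets :
    X.indicator (1 : G → ZMod 2) ∈ almostInvariantSets H ↔ IsAlmostInvariant H X := by
  refine forall_congr' fun g => ?_
  change IsHFinite H (Function.support _) ↔ _
  convert Iff.rfl using 2
  ext x
  by_cases h1 : x ∈ X <;> by_cases h2 : x * g ∈ X <;> simp [flipSet, h1, h2]

theorem isAlmostInvariant_univ : IsAlmostInvariant H (Set.univ : Set G) := fun g =>
  IsHFinite.of_finite (by simp [flipSet])

/-- If every almost invariant set were `H`-finite or had `H`-finite complement, the class of the
whole group would span the quotient. -/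
theorem exists_almostInvariant_of_two_le (h : 2 ≤ relativeEnds H) :
    ∃ X, IsAlmostInvariant H X ∧ ¬ IsHFinite H X ∧ ¬ IsHFinite H Xᶜ := by
  by_contra! hcon
  have key : Module.rank (ZMod 2)
      (almostInvariantSets H ⧸ (hFiniteSets H).submoduleOf (almostInvariantSets H)) ≤ 1 := by
    rw [rank_le_one_iff]
    refine ⟨Submodule.Quotient.mk ⟨_, indicator_mem_almostInvariantSets.2
      (isAlmostInvariant_univ (H := H))⟩, fun v => ?_⟩
    obtain ⟨⟨f, hf⟩, rfl⟩ := Submodule.Quotient.mk_surjective _ v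
    set X := Function.support f with hX
    have hfX := eq_indicator_support f
    rw [← hX] at hfX
    have hXa : IsAlmostInvariant H X := indicator_mem_almostInvariantSets.1 (hfX ▸ hf)
    by_cases hXf : IsHFinite H X
    · refine ⟨0, ?_⟩
      rw [zero_smul, eq_comm, Submodule.Quotient.mk_eq_zero]
      exact hXf
    · refine ⟨1, ?_⟩
      rw [one_smul, Submodule.Quotient.eq]
      change Set.univ.indicator 1 - f ∈ hFiniteSets H
      rw [hfX, ← indicator_compl_eq, indicator_mem_hFiniteSets]
      exact hcon X hXa hXf
  have h1 : relativeEnds H ≤ 1 := by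
    unfold relativeEnds
    simpa using Cardinal.toENat.monotone' key
  exact absurd (h.trans h1) (by decide)

theorem infinite_of_numEnds_eq_one (h : numEnds G = 1) : Infinite G := by
  by_contra hfin
  rw [not_infinite_iff_finite] at hfin
  have : Subsingleton (almostInvariantSets (⊥ : Subgroup G) ⧸
      (hFiniteSets (⊥ : Subgroup G)).submoduleOf (almostInvariantSets ⊥)) := by
    rw [Submodule.Quotient.subsingleton_iff, eq_top_iff]
    rintro ⟨f, hf⟩ -
    exact isHFinite_bot_iff.2 (Set.toFinite (Function.support f))
  unfold numEnds relativeEnds at h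
  simp at h

/-- The group is infinite, so the class of the whole group is nonzero and spans the one-dimensional
quotient. The class of `X` is therefore 0 or that class. -/
theorem finite_or_finite_compl_of_numEnds_eq_one (h : numEnds G = 1)
    (hX : IsAlmostInvariant ⊥ X) : X.Finite ∨ Xᶜ.Finite := by
  have hinf := infinite_of_numEnds_eq_one h
  have hr : Module.finrank (ZMod 2) (almostInvariantSets (⊥ : Subgroup G) ⧸
      (hFiniteSets (⊥ : Subgroup G)).submoduleOf (almostInvariantSets ⊥)) = 1 := by
    unfold numEnds relativeEnds at h
    rw [Cardinal.toENat_eq_one] at h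
    rw [Module.finrank, h, Cardinal.one_toNat]
  let u : almostInvariantSets (⊥ : Subgroup G) :=
    ⟨_, indicator_mem_almostInvariantSets.2 (isAlmostInvariant_univ (G := G))⟩
  have hu : Submodule.Quotient.mk (p := (hFiniteSets (⊥ : Subgroup G)).submoduleOf
      (almostInvariantSets ⊥)) u ≠ 0 := by
    rw [Ne, Submodule.Quotient.mk_eq_zero]
    intro h0
    have h0' : Set.univ.indicator (1 : G → ZMod 2) ∈ hFiniteSets ⊥ := h0
    rw [indicator_mem_hFiniteSets, isHFinite_bot_iff] at h0'
    exact Set.infinite_univ h0'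
  obtain ⟨c, hc⟩ := (finrank_eq_one_iff_of_nonzero' _ hu).1 hr
    (Submodule.Quotient.mk ⟨_, indicator_mem_almostInvariantSets.2 hX⟩)
  have hc01 : c = 0 ∨ c = 1 := by clear hc; revert c; decide
  rcases hc01 with rfl | rfl
  · left
    rw [zero_smul, eq_comm, Submodule.Quotient.mk_eq_zero] at hc
    have hc' : X.indicator (1 : G → ZMod 2) ∈ hFiniteSets ⊥ := hc
    rwa [indicator_mem_hFiniteSets, isHFinite_bot_iff] at hc'
  · right
    rw [one_smul, Submodule.Quotient.eq] at hc
    have hc' : Set.univ.indicator 1 - X.indicator (1 : G → ZMod 2) ∈ hFiniteSets ⊥ := hc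
    rwa [← indicator_compl_eq, indicator_mem_hFiniteSets, isHFinite_bot_iff] at hc'

end basics

/-! ### Nested families of sets and their dual trees -/

section TreeSets

variable {α : Type*}

/-- A nested family of nontrivial subsets that is closed under complements and in which every pair
of points is separated by only finitely many members. -/
structure IsTreeSet (E : Set (Set α)) : Prop where
  compl_mem : ∀ e ∈ E, eᶜ ∈ E
  nonempty : ∀ e ∈ E, e.Nonempty
  nested : ∀ e ∈ E, ∀ f ∈ E, e ⊆ f ∨ e ⊆ fᶜ ∨ eᶜ ⊆ f ∨ eᶜ ⊆ fᶜ
  finite : ∀ x y, {e ∈ E | x ∈ e ∧ y ∉ e}.Finite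

/-- Two members of `E` point away from the same vertex of the dual tree: they are equal, or the
first is covered by the complement of the second. -/
def SameOrigin (E : Set (Set α)) (e f : Set α) : Prop :=
  e = f ∨ (e ⊂ fᶜ ∧ ∀ x ∈ E, e ⊂ x → ¬ x ⊂ fᶜ)

variable {E : Set (Set α)} {e f g : Set α}

theorem ssubset_compl_comm : e ⊂ fᶜ ↔ f ⊂ eᶜ := by
  have h := compl_lt_compl_iff_lt (x := e) (y := fᶜ)
  rw [compl_compl] at h
  exact h.symm

theorem SameOrigin.refl (E : Set (Set α)) (e : Set α) : SameOrigin E e e := Or.inl rfl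

theorem SameOrigin.disjoint (h : SameOrigin E e f) (hne : e ≠ f) : e ⊆ fᶜ :=
  (h.resolve_left hne).1.subset

namespace IsTreeSet

variable (hE : IsTreeSet E)
include hE

theorem compl_nonempty (he : e ∈ E) : eᶜ.Nonempty := hE.nonempty _ (hE.compl_mem _ he)

theorem symm (h : SameOrigin E e f) : SameOrigin E f e := by
  rcases h with h | ⟨h, h'⟩
  · exact Or.inl h.symm
  · refine Or.inr ⟨ssubset_compl_comm.1 h, fun x hx hfx hxe => ?_⟩
    refine h' xᶜ (hE.compl_mem x hx) (ssubset_compl_comm.1 hxe) ?_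
    exact compl_lt_compl_iff_lt.2 hfx

/-- This is what makes vertices well defined, as classes of oriented edges. Of the four nested
positions of `e` and `g`, all but disjointness contradict a covering relation with `fᶜ` or the
nonemptiness of `f`. A member strictly between `e` and `gᶜ` is excluded by comparing it with `f`. -/
theorem trans (he : e ∈ E) (hf : f ∈ E) (hg : g ∈ E) (h₁ : SameOrigin E e f)
    (h₂ : SameOrigin E f g) : SameOrigin E e g := by
  by_cases heg : e = g
  · exact Or.inl heg
  have h₂' := hE.symm h₂
  rcases h₁ with rfl | ⟨h₁, c₁⟩
  · exact h₂
  rcases h₂ with rfl | ⟨h₂, c₂⟩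
  · exact Or.inr ⟨h₁, c₁⟩
  have hgf : g ⊂ fᶜ := ssubset_compl_comm.1 h₂
  have c₃ : ∀ x ∈ E, g ⊂ x → ¬ x ⊂ fᶜ := by
    rcases h₂' with rfl | h
    · exact absurd hgf.subset fun h => by
        obtain ⟨x, hx⟩ := hE.nonempty _ hg
        exact h hx hx
    · exact h.2
  have hfne := hE.nonempty f hf
  refine Or.inr ⟨?_, fun x hx hex hxg => ?_⟩
  · have hsub : e ⊆ gᶜ := by
      rcases hE.nested e he g hg with h | h | h | h
      · exact absurd hgf (c₁ g hg (h.ssubset_of_ne heg))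
      · exact h
      · obtain ⟨x, hx⟩ := hfne
        have hxe : x ∉ e := fun hxe => h₁.subset hxe hx
        exact absurd (h hxe) (h₂.subset hx)
      · exact absurd h₁ (c₃ e he ((Set.compl_subset_compl.1 h).ssubset_of_ne (Ne.symm heg)))
    refine hsub.ssubset_of_ne fun h => ?_
    obtain ⟨x, hx⟩ := hfne
    exact h₁.subset (h ▸ h₂.subset hx) hx
  · rcases hE.nested x hx f hf with h | h | h | h
    · obtain ⟨y, hy⟩ := hE.nonempty e he
      exact h₁.subset hy (h (hex.subset hy))
    · have hxf : x = fᶜ := by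
        by_contra hne
        exact c₁ x hx hex (h.ssubset_of_ne hne)
      have h3 : g ⊆ f := Set.compl_subset_compl.1 (hxf ▸ hxg).subset
      obtain ⟨y, hy⟩ := hE.nonempty g hg
      exact hgf.subset hy (h3 hy)
    · obtain ⟨y, hy⟩ := hE.nonempty g hg
      have hyx : y ∉ x := fun hyx => hxg.subset hyx hy
      exact hgf.subset hy (h hyx)
    · have hfx : f ⊆ x := Set.compl_subset_compl.1 h
      by_cases hxf : f = x
      · subst hxf
        obtain ⟨y, hy⟩ := hE.nonempty e he
        exact h₁.subset hy (hex.subset hy)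
      · exact c₂ x hx (hfx.ssubset_of_ne hxf) hxg

theorem finite_between (he : e ∈ E) (hf : f ∈ E) : {x ∈ E | e ⊂ x ∧ x ⊆ f}.Finite := by
  obtain ⟨a, ha⟩ := hE.nonempty e he
  obtain ⟨b, hb⟩ := hE.compl_nonempty hf
  exact (hE.finite a b).subset fun x hx => ⟨hx.1, hx.2.1.subset ha, fun h => hb (hx.2.2 h)⟩

theorem exists_cover (he : e ∈ E) (hf : f ∈ E) (hef : e ⊂ f) :
    ∃ c ∈ E, e ⊂ c ∧ c ⊆ f ∧ SameOrigin E e cᶜ := by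
  obtain ⟨c, hc⟩ := (hE.finite_between he hf).exists_minimal ⟨f, hf, hef, subset_rfl⟩
  refine ⟨c, hc.1.1, hc.1.2.1, hc.1.2.2, Or.inr ?_⟩
  rw [compl_compl]
  refine ⟨hc.1.2.1, fun x hx hex hxc => ?_⟩
  exact hxc.not_subset (hc.2 ⟨hx, hex, hxc.subset.trans hc.1.2.2⟩ hxc.subset)

/-- Induction along the edge path from `e` to `f`: a cover `c` of `e` below `f` is reached by
passing to `cᶜ` at the origin of `e` and reversing, and fewer members remain between `c` and `f`. -/
theorem mem_of_subset {O : Set (Set α)} (hO : ∀ e ∈ O, eᶜ ∈ O)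
    (hstar : ∀ e ∈ O, ∀ f ∈ E, SameOrigin E e f → f ∈ O) (hf : f ∈ E) :
    ∀ (n : ℕ) (e : Set α), e ∈ E → e ∈ O → e ⊆ f → {x ∈ E | e ⊂ x ∧ x ⊆ f}.ncard = n → f ∈ O := by
  intro n
  induction n using Nat.strong_induction_on with
  | _ n ih =>
    intro e he heO hef hn
    by_cases h : e = f
    · exact h ▸ heO
    obtain ⟨c, hc, hec, hcf, hs⟩ := hE.exists_cover he hf (hef.ssubset_of_ne h)
    have hcO : c ∈ O := by
      have := hO _ (hstar e heO _ (hE.compl_mem c hc) hs)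
      rwa [compl_compl] at this
    refine ih _ ?_ c hc hcO hcf rfl
    rw [← hn]
    refine Set.ncard_lt_ncard ⟨fun x hx => ⟨hx.1, hec.trans hx.2.1, hx.2.2⟩, fun hsub => ?_⟩
      (hE.finite_between he hf)
    exact (hsub ⟨hc, hec, hcf⟩ : c ∈ E ∧ c ⊂ c ∧ c ⊆ f).2.1.ne rfl

/-- The dual tree is connected: a set of oriented edges closed under reversal and under passing to
edges with the same origin contains every edge. -/
theorem subset_of_closed {O : Set (Set α)} (hO : ∀ e ∈ O, eᶜ ∈ O)
    (hstar : ∀ e ∈ O, ∀ f ∈ E, SameOrigin E e f → f ∈ O) (he : e ∈ E) (heO : e ∈ O) : E ⊆ O := by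
  intro f hf
  rcases hE.nested e he f hf with h | h | h | h
  · exact hE.mem_of_subset hO hstar hf _ e he heO h rfl
  · simpa using hO _ (hE.mem_of_subset hO hstar (hE.compl_mem f hf) _ e he heO h rfl)
  · exact hE.mem_of_subset hO hstar hf _ _ (hE.compl_mem e he) (hO e heO) h rfl
  · simpa using hO _
      (hE.mem_of_subset hO hstar (hE.compl_mem f hf) _ _ (hE.compl_mem e he) (hO e heO) h rfl)

end IsTreeSet

end TreeSets

/-! ### Groups acting with one orbit of unoriented edges -/

section EdgeTransitive

variable {G α : Type*} [Group G] [MulAction G α]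

/-- The translates of `Y` and their complements. -/
def translates (G : Type*) {α : Type*} [Group G] [MulAction G α] (Y : Set α) : Set (Set α) :=
  {e | ∃ g : G, e = g • Y ∨ e = g • Yᶜ}

variable {Y : Set α}

theorem self_mem_translates : Y ∈ translates G Y := ⟨1, Or.inl (one_smul G Y).symm⟩

theorem smul_mem_translates (g : G) {e : Set α} (he : e ∈ translates G Y) :
    g • e ∈ translates G Y := by
  obtain ⟨k, rfl | rfl⟩ := he
  · exact ⟨g * k, Or.inl (mul_smul g k Y).symm⟩
  · exact ⟨g * k, Or.inr (mul_smul g k _).symm⟩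

theorem compl_mem_translates {e : Set α} (he : e ∈ translates G Y) : eᶜ ∈ translates G Y := by
  obtain ⟨k, rfl | rfl⟩ := he
  · exact ⟨k, Or.inr (Set.smul_set_compl ..).symm⟩
  · exact ⟨k, Or.inl (by rw [Set.smul_set_compl, compl_compl])⟩

theorem compl_self_mem_translates : Yᶜ ∈ translates G Y := compl_mem_translates self_mem_translates

theorem smul_set_ssubset {e f : Set α} (g : G) (h : e ⊂ f) : g • e ⊂ g • f :=
  ⟨Set.smul_set_mono h.1, fun h' => h.2 (Set.smul_set_subset_smul_set_iff.1 h')⟩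

theorem SameOrigin.smul {e f : Set α} (g : G) (h : SameOrigin (translates G Y) e f) :
    SameOrigin (translates G Y) (g • e) (g • f) := by
  rcases h with rfl | ⟨h, h'⟩
  · exact Or.inl rfl
  · refine Or.inr ⟨by rw [← Set.smul_set_compl]; exact smul_set_ssubset g h, fun x hx hex hxf => ?_⟩
    refine h' (g⁻¹ • x) (smul_mem_translates _ hx) ?_ ?_
    · simpa using smul_set_ssubset g⁻¹ hex
    · simpa [← Set.smul_set_compl] using smul_set_ssubset g⁻¹ hxf

/-- The stabilizer of the origin of the oriented edge `e`. -/
def originStabilizer (hE : IsTreeSet (translates G Y)) {e : Set α} (he : e ∈ translates G Y) :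
    Subgroup G where
  carrier := {g | SameOrigin (translates G Y) e (g • e)}
  one_mem' := by simpa using SameOrigin.refl _ e
  mul_mem' := fun {a b} ha hb => hE.trans he (smul_mem_translates _ he) (smul_mem_translates _ he)
    ha (by simpa [mul_smul] using SameOrigin.smul a hb)
  inv_mem' := fun {a} ha => hE.symm (by simpa using SameOrigin.smul a⁻¹ ha)

variable (hE : IsTreeSet (translates G Y))

theorem mem_originStabilizer {e : Set α} {he : e ∈ translates G Y} {g : G} :
    g ∈ originStabilizer hE he ↔ SameOrigin (translates G Y) e (g • e) := Iff.rfl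

theorem stabilizer_le_originStabilizer {e : Set α} (he : e ∈ translates G Y) :
    MulAction.stabilizer G e ≤ originStabilizer hE he := fun g hg => by
  rw [mem_originStabilizer, MulAction.mem_stabilizer_iff.1 hg]
  exact SameOrigin.refl _ e

include hE in
-- Connectedness puts every edge in the `M`-orbit of `Y` or `Yᶜ`. Without inversions `g • Y = m • Y`
-- for some `m` in `M`, and `M` contains the edge stabilizer.
theorem eq_top_of_star_mem (hinv : ∀ g : G, g • Y ≠ Yᶜ) {M : Subgroup G}
    (hL : MulAction.stabilizer G Y ≤ M)
    (h : ∀ e, e = Y ∨ e = Yᶜ → ∀ f ∈ translates G Y, SameOrigin (translates G Y) e f →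
      ∃ m ∈ M, f = m • Y ∨ f = m • Yᶜ) : M = ⊤ := by
  have key : translates G Y ⊆ {f | ∃ m ∈ M, f = m • Y ∨ f = m • Yᶜ} := by
    refine hE.subset_of_closed ?_ ?_ self_mem_translates ⟨1, M.one_mem, Or.inl (one_smul G Y).symm⟩
    · rintro e ⟨m, hm, rfl | rfl⟩
      · exact ⟨m, hm, Or.inr (Set.smul_set_compl ..).symm⟩
      · exact ⟨m, hm, Or.inl (by rw [Set.smul_set_compl, compl_compl])⟩
    · intro e ⟨m, hm, hem⟩ f hf hs
      have hs' := hs.smul m⁻¹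
      obtain ⟨k, hk, hkf⟩ := h (m⁻¹ • e) (by rcases hem with rfl | rfl <;> simp) (m⁻¹ • f)
        (smul_mem_translates _ hf) hs'
      refine ⟨m * k, M.mul_mem hm hk, ?_⟩
      simpa only [mul_smul, inv_smul_eq_iff] using hkf
  rw [eq_top_iff]
  intro g _
  obtain ⟨m, hm, h | h⟩ := key (smul_mem_translates g self_mem_translates)
  · have : m⁻¹ * g ∈ M := hL (by rw [MulAction.mem_stabilizer_iff, mul_smul, h, inv_smul_smul])
    simpa using M.mul_mem hm this
  · exact absurd (by rw [mul_smul, h, inv_smul_smul]) (hinv (m⁻¹ * g))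

end EdgeTransitive

/-! ### Ping-pong for amalgams and HNN extensions -/

section PingPong

variable {G α : Type*} [Group G] [MulAction G α]

open Monoid PushoutI in
/-- Ping-pong for pushouts of two groups, with complementary ping-pong sets that are not
exchanged by any group element. -/
theorem pushoutLift_injective {ι C : Type*} [Group C] {P : ι → Type*} [∀ i, Group (P i)]
    {φ : ∀ i, C →* P i} (hφ : ∀ i, Function.Injective (φ i)) {f : ∀ i, P i →* G} {k : C →* G}
    (hf : ∀ i, (f i).comp (φ i) = k) (hk : Function.Injective k)
    {Z : ι → Set α} (hZ : ∀ i j, i ≠ j → Z i = (Z j)ᶜ) (hne : ∀ i, (Z i).Nonempty)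
    (hPZ : ∀ i, ∀ g : P i, g ∉ (φ i).range → f i g • Z i ⊆ (Z i)ᶜ)
    (hinv : ∀ g : G, ∀ i, g • Z i ≠ (Z i)ᶜ) :
    Function.Injective (PushoutI.lift f k hf) := by
  classical
  set F := PushoutI.lift f k hf with hF
  obtain ⟨d⟩ := NormalWord.transversal_nonempty φ hφ
  have hfφ : ∀ i c, f i (φ i c) = k c := fun i c => DFunLike.congr_fun (hf i) c
  -- A word outside the base group, with first syllable in the factor `i`, maps one of the ping-pong
  -- sets into a translate of `Z i` by an element of that factor outside the amalgamated subgroup.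
  have key : ∀ w : NormalWord d, (∃ h, w.prod = base φ h) ∨ ∃ i j, ∃ g : P i, g ∉ (φ i).range ∧
      w.fstIdx = some i ∧ F w.prod • Z j ⊆ f i g • Z i := by
    intro w
    induction w using NormalWord.consRecOn with
    | empty => exact Or.inl ⟨1, by simp⟩
    | cons i g w hmw hgn hgr hw1 ih =>
      right
      have hfst : (NormalWord.cons g w hmw hgr).fstIdx = some i := by
        simp only [NormalWord.cons, CoprodI.Word.fstIdx_cons]
      rcases ih with ⟨h, hh⟩ | ⟨i', j, g', hg', hi', hsub⟩
      · refine ⟨i, i, g * φ i h,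
          fun hmem => hgr ((Subgroup.mul_mem_cancel_right _
            (MonoidHom.mem_range.2 ⟨h, rfl⟩)).1 hmem), hfst, ?_⟩
        rw [NormalWord.prod_cons, map_mul, hh, hF, lift_of, lift_base, map_mul, hfφ]
      · have hii : i ≠ i' := fun h => hmw (h ▸ hi')
        refine ⟨i, j, g, hgr, hfst, ?_⟩
        rw [NormalWord.prod_cons, map_mul, mul_smul, hF, lift_of, hZ i i' hii]
        exact Set.smul_set_mono (hsub.trans (hPZ i' g' hg'))
    | base h w hw ih =>
      rcases ih with ⟨h', hh⟩ | ⟨i, j, g', hg', hi, hsub⟩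
      · exact Or.inl ⟨h * h', by rw [NormalWord.prod_smul, hh, map_mul]⟩
      · right
        refine ⟨i, j, φ i h * g',
          fun hmem => hg' ((Subgroup.mul_mem_cancel_left _
            (MonoidHom.mem_range.2 ⟨h, rfl⟩)).1 hmem), ?_, ?_⟩
        · rw [NormalWord.base_smul_eq_smul]; exact hi
        · rw [NormalWord.prod_smul, map_mul, mul_smul, map_mul, mul_smul, hF, lift_base, hfφ]
          exact Set.smul_set_mono hsub
  rw [injective_iff_map_eq_one]
  intro x hx
  obtain ⟨w, rfl⟩ := (NormalWord.equiv (d := d)).symm.surjective x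
  change F w.prod = 1 at hx
  change w.prod = 1
  rcases key w with ⟨h, hh⟩ | ⟨i, j, g, hg, -, hsub⟩
  · rw [hh, hF, lift_base] at hx
    rw [hh, (injective_iff_map_eq_one k).1 hk h hx, map_one]
  · exfalso
    rw [hx, one_smul] at hsub
    by_cases hij : j = i
    · subst hij
      obtain ⟨x, hxj⟩ := hne j
      exact hPZ j g hg (hsub hxj) hxj
    -- Here ping-pong alone gives no contradiction: the inclusions only force `f i g • Z i` to equal
    -- the complement of `Z i`, an exchange excluded by `hinv`.
    · rw [hZ j i hij] at hsub
      exact hinv (f i g) i ((hPZ i g hg).antisymm hsub)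

open HNNExtension in
/-- Ping-pong for HNN extensions. -/
theorem hnnLift_injective {A : Subgroup G} {C B : Subgroup A} {φ : C ≃* B} {t : G}
    (ht : ∀ a : C, t * A.subtype (a : A) = A.subtype (φ a : A) * t)
    {Q P : Set α} (htP : t • Qᶜ = P) (hAPQ : ∀ a ∈ A, a • P ⊆ Qᶜ)
    (hQ : ∀ a : A, a ∉ C → (a : G) • Q ⊆ Qᶜ) (hP : ∀ a : A, a ∉ B → (a : G) • P ⊆ Pᶜ)
    (hcov : ∀ a ∈ A, ∀ b ∈ A, ∀ e f : Set α, e = Q ∨ e = P → f = Q ∨ f = P →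
      ¬ (a • e)ᶜ ⊆ b • f) :
    Function.Injective (HNNExtension.lift A.subtype t ht) := by
  set F := HNNExtension.lift A.subtype t ht with hF
  obtain ⟨d⟩ := NormalWord.TransversalPair.nonempty A C B
  -- Indexed by the exponent of the stable letter, so that `t ^ u` carries the complement of `Z
  -- (-u)` onto `Z u`.
  let Z : ℤˣ → Set α := fun u => if u = 1 then P else Q
  have hZ1 : Z 1 = P := if_pos rfl
  have hZ2 : Z (-1) = Q := if_neg (by decide)
  have hZ : ∀ u, Z u = Q ∨ Z u = P := fun u => by
    rcases Int.units_eq_one_or u with rfl | rfl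
    · exact Or.inr hZ1
    · exact Or.inl hZ2
  have htZ : ∀ u : ℤˣ, t ^ (u : ℤ) • (Z (-u))ᶜ = Z u := fun u => by
    rcases Int.units_eq_one_or u with rfl | rfl
    · simpa [hZ1, hZ2] using htP
    · rw [neg_neg, hZ1, hZ2, ← htP]
      simp [Set.smul_set_compl]
  have hAQP : ∀ a ∈ A, a • Q ⊆ Pᶜ := fun a ha => by
    rw [Set.subset_compl_comm, ← Set.smul_set_compl, Set.subset_smul_set_iff]
    exact hAPQ _ (A.inv_mem ha)
  -- The hypothesis on `a` is exactly the absence of a pinch between consecutive stable letters of a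
  -- reduced word.
  have hsep : ∀ (u u' : ℤˣ) (a : A), (a ∈ toSubgroup C B u → u = u') →
      (a : G) • Z u' ⊆ (Z (-u))ᶜ := fun u u' a h => by
    rcases Int.units_eq_one_or u with rfl | rfl <;> rcases Int.units_eq_one_or u' with rfl | rfl
    · rw [hZ1, hZ2]; exact hAPQ a a.2
    · rw [hZ2]; exact hQ a fun ha => absurd (h ha) (by decide)
    · rw [neg_neg, hZ1]; exact hP a fun ha => absurd (h ha) (by decide)
    · rw [neg_neg, hZ1, hZ2]; exact hAQP a a.2
  have key : ∀ w : NormalWord d, (∃ g, w = NormalWord.ofGroup g) ∨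
      ∃ u ∈ Option.map Prod.fst w.toList.head?, ∃ v, ∃ a ∈ A,
        F (w.prod φ) • (a • Z v)ᶜ ⊆ (w.head : G) • Z u := by
    intro w
    induction w using NormalWord.consRecOn with
    | ofGroup g => exact Or.inl ⟨g, rfl⟩
    | cons g u w h1 h2 ih =>
      right
      refine ⟨u, by simp, ?_⟩
      have hprod : F ((NormalWord.cons g u w h1 h2).prod φ) =
          g * (t ^ (u : ℤ) * F (w.prod φ)) := by
        rw [NormalWord.prod_cons, map_mul, map_mul, map_zpow, hF, lift_of, lift_t]
        rfl
      rw [hprod, NormalWord.cons_head]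
      rcases ih with ⟨g', rfl⟩ | ⟨u', hu', v, a, ha, hsub⟩
      · refine ⟨-u, (g' : G)⁻¹, A.inv_mem g'.2, ?_⟩
        rw [mul_smul]
        have : F ((NormalWord.ofGroup g' : NormalWord d).prod φ) = g' := by
          simp [NormalWord.ReducedWord.prod, hF]
        rw [this, mul_smul, ← Set.smul_set_compl, smul_inv_smul, htZ]
      · refine ⟨v, a, ha, ?_⟩
        rw [mul_smul, mul_smul, ← htZ u]
        refine Set.smul_set_mono ?_
        exact Set.smul_set_mono (hsub.trans (hsep u u' w.head (h2 u' hu')))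
  rw [injective_iff_map_eq_one]
  intro x hx
  obtain ⟨w, rfl⟩ := (NormalWord.equiv φ d).symm.surjective x
  change F (w.prod φ) = 1 at hx
  change w.prod φ = 1
  rcases key w with ⟨g, rfl⟩ | ⟨u, -, v, a, ha, hsub⟩
  · have h1 : (NormalWord.ofGroup g : NormalWord d).prod φ = HNNExtension.of g := by
      simp [NormalWord.ReducedWord.prod]
    rw [h1, hF, lift_of] at hx
    rw [h1, show g = 1 from Subtype.ext hx, map_one]
  · rw [hx, one_smul] at hsub
    exact absurd hsub (hcov a ha w.head w.head.2 _ _ (hZ v) (hZ u))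

end PingPong

/-! ### The splitting given by an edge-transitive action on the dual tree -/

section Splitting

variable {G α : Type*} [Group G] [MulAction G α] {Y : Set α}

/-- The two ends of the edge `Y` lie in different orbits, and the factors are their stabilizers. A
member strictly above `Y`, or strictly below it, yields a second edge at the corresponding end,
which makes that factor larger than the edge group. -/
theorem isNontrivialAmalgamOver_stabilizer (hE : IsTreeSet (translates G Y))
    (hinv : ∀ g : G, g • Y ≠ Yᶜ) (hlt : ∃ e ∈ translates G Y, e ⊂ Y)
    (hgt : ∃ e ∈ translates G Y, Y ⊂ e)
    (hno : ∀ g : G, ¬ SameOrigin (translates G Y) Y (g • Yᶜ)) :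
    IsNontrivialAmalgamOver (MulAction.stabilizer G Y) := by
  let Z : Fin 2 → Set α := ![Y, Yᶜ]
  have hZ0 : Z 0 = Y := rfl
  have hZ1 : Z 1 = Yᶜ := rfl
  have hZmem : ∀ i, Z i ∈ translates G Y :=
    Fin.forall_fin_two.2 ⟨self_mem_translates, compl_self_mem_translates⟩
  have hZ : ∀ i j, i ≠ j → Z i = (Z j)ᶜ := by
    simp [Fin.forall_fin_two, hZ0, hZ1]
  have hstab : ∀ i (g : G), g ∈ MulAction.stabilizer G Y ↔ g • Z i = Z i := by
    simp [Fin.forall_fin_two, hZ0, hZ1, Set.smul_set_compl]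
  have hinvZ : ∀ g : G, ∀ i, g • Z i ≠ (Z i)ᶜ := by
    refine fun g => Fin.forall_fin_two.2 ⟨hinv g, fun h => hinv g ?_⟩
    rwa [hZ1, Set.smul_set_compl, compl_inj_iff] at h
  have hnoZ : ∀ i j, i ≠ j → ∀ g : G, ¬ SameOrigin (translates G Y) (Z i) (g • Z j) := by
    simp only [Fin.forall_fin_two, hZ0, hZ1]
    refine ⟨⟨by simp, fun _ => hno⟩, fun _ g h => hno g⁻¹ (hE.symm ?_), by simp⟩
    simpa using h.smul g⁻¹
  have hstar : ∀ i, ∀ f ∈ translates G Y, SameOrigin (translates G Y) (Z i) f →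
      ∃ g : G, f = g • Z i := by
    rintro i f ⟨g, hf⟩ hs
    have h2 : ∃ j, f = g • Z j := hf.elim (fun h => ⟨0, h⟩) (fun h => ⟨1, h⟩)
    obtain ⟨j, rfl⟩ := h2
    by_cases hij : i = j
    · exact ⟨g, by rw [hij]⟩
    · exact absurd hs (hnoZ i j hij g)
  have hgtZ : ∀ i, ∃ e ∈ translates G Y, Z i ⊂ e := by
    refine Fin.forall_fin_two.2 ⟨hgt, ?_⟩
    obtain ⟨e, he, hlt⟩ := hlt
    exact ⟨eᶜ, compl_mem_translates he, compl_lt_compl_iff_lt.2 hlt⟩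
  let P : Fin 2 → Subgroup G := fun i => originStabilizer hE (hZmem i)
  have hCP : ∀ i, MulAction.stabilizer G Y < P i := by
    intro i
    refine lt_of_le_of_ne (fun g hg => ?_) fun heq => ?_
    · exact stabilizer_le_originStabilizer hE (hZmem i) ((hstab i g).1 hg)
    · obtain ⟨e, he, hlt⟩ := hgtZ i
      obtain ⟨c, hc, hic, -, hs⟩ := hE.exists_cover (hZmem i) he hlt
      obtain ⟨g, hg⟩ := hstar i _ (hE.compl_mem c hc) hs
      have hgP : g ∈ P i := by rw [mem_originStabilizer, ← hg]; exact hs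
      rw [← heq, hstab i, ← hg] at hgP
      obtain ⟨x, hx⟩ := hE.nonempty _ (hZmem i)
      have hx' := hx
      rw [← hgP] at hx'
      exact hx' (hic.subset hx)
  refine ⟨P, hCP, ?_, ?_⟩
  · refine pushoutLift_injective (Z := Z) (fun i => Subgroup.inclusion_injective (hCP i).le) _
      (Subgroup.subtype_injective _) hZ (fun i => hE.nonempty _ (hZmem i)) ?_ hinvZ
    intro i g hg
    have hne : (g : G) • Z i ≠ Z i := fun h => hg ⟨⟨g, (hstab i g).2 h⟩, Subtype.ext rfl⟩
    exact (hE.symm ((mem_originStabilizer hE).1 g.2)).disjoint hne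
  · rw [← MonoidHom.range_eq_top]
    have hPM : ∀ i, P i ≤ (Monoid.PushoutI.lift (φ := fun i => Subgroup.inclusion (hCP i).le)
        (fun i => (P i).subtype) (MulAction.stabilizer G Y).subtype (fun _ => rfl)).range :=
      fun i g hg => ⟨Monoid.PushoutI.of i ⟨g, hg⟩,
        Monoid.PushoutI.lift_of (fun i => (P i).subtype) _ (fun _ => rfl) (⟨g, hg⟩ : P i)⟩
    refine eq_top_of_star_mem hE hinv ((hCP 0).le.trans (hPM 0)) fun e he f hf hs => ?_
    have hei : ∃ i, e = Z i := he.elim (fun h => ⟨0, h⟩) (fun h => ⟨1, h⟩)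
    obtain ⟨i, rfl⟩ := hei
    obtain ⟨g, rfl⟩ := hstar i f hf hs
    refine ⟨g, hPM i hs, ?_⟩
    revert i
    simp [Fin.forall_fin_two, hZ0, hZ1]

/-- The element `t` moves the origin of `Yᶜ` to that of `Y`, so the ends of the edge are in one
orbit. The base group is the stabilizer of the origin of `Y`, where `Y` and `P = t • Yᶜ` represent
the two classes of outgoing edges. -/
theorem isHNNExtensionOver_stabilizer (hE : IsTreeSet (translates G Y))
    (hinv : ∀ g : G, g • Y ≠ Yᶜ) {t : G} (hts : SameOrigin (translates G Y) Y (t • Yᶜ)) :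
    IsHNNExtensionOver (MulAction.stabilizer G Y) := by
  have hY : Y ∈ translates G Y := self_mem_translates
  set L := MulAction.stabilizer G Y with hL
  set A := originStabilizer hE hY with hA
  set P := t • Yᶜ with hP
  have hPmem : P ∈ translates G Y := ⟨t, Or.inr rfl⟩
  have hLA : L ≤ A := stabilizer_le_originStabilizer hE hY
  have hLc : ∀ g, g ∈ L ↔ g • Yᶜ = Yᶜ := fun g => by
    rw [hL, MulAction.mem_stabilizer_iff, Set.smul_set_compl, compl_inj_iff]
  have hconjA : ∀ l ∈ L, t * l * t⁻¹ ∈ A := by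
    intro l hl
    have h := hts.smul (t * l * t⁻¹)
    have : (t * l * t⁻¹) • P = P := by
      rw [hP, mul_smul, mul_smul, inv_smul_smul, (hLc l).1 hl]
    rw [this] at h
    exact hE.trans hY hPmem (smul_mem_translates _ hY) hts (hE.symm h)
  have hAP : ∀ a ∈ A, SameOrigin (translates G Y) Y (a • P) := fun a ha =>
    hE.trans hY (smul_mem_translates _ hY) (smul_mem_translates _ hPmem) ha (hts.smul a)
  -- The second associated subgroup is `tLt⁻¹`, the stabilizer of `P`; it lies in `A` by `hconjA`.
  let B : Subgroup A := (L.comap (MulAut.conj t⁻¹).toMonoidHom).comap A.subtype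
  have hB : ∀ a : A, a ∈ B ↔ t⁻¹ * a * t ∈ L := fun a => by
    change t⁻¹ * a * t⁻¹⁻¹ ∈ L ↔ _
    rw [inv_inv]
  let φ : L.subgroupOf A ≃* B :=
    { toFun := fun a => ⟨⟨t * a * t⁻¹, hconjA _ a.2⟩, by
        rw [hB]; simpa [mul_assoc] using Subgroup.mem_subgroupOf.1 a.2⟩
      invFun := fun b => ⟨⟨t⁻¹ * b * t, hLA ((hB b).1 b.2)⟩, (hB b).1 b.2⟩
      left_inv := fun a => by ext; simp [mul_assoc]
      right_inv := fun b => by ext; simp [mul_assoc]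
      map_mul' := fun a b => by ext; simp [mul_assoc] }
  have ht : ∀ a : L.subgroupOf A, t * A.subtype (a : A) = A.subtype (φ a : A) * t := fun a => by
    simp [φ]
  have hPB : ∀ a : A, a ∉ B → (a : G) • P ≠ P := fun a ha h => ha <| by
    rw [hB, hLc, mul_smul, mul_smul, ← hP, h, hP, inv_smul_smul]
  refine ⟨A, hLA, B, φ, t, ht, ?_, ?_⟩
  · refine hnnLift_injective ht (Q := Y) (P := P) rfl ?_ ?_ ?_ ?_
    · intro a ha
      refine (hE.symm (hAP a ha)).disjoint fun h => hinv (a * t) ?_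
      rw [hP, ← mul_smul, Set.smul_set_compl, compl_eq_comm] at h
      exact h.symm
    · intro a ha
      exact (hE.symm ((mem_originStabilizer hE).1 a.2)).disjoint fun h => ha h
    · intro a ha
      exact (hE.trans (smul_mem_translates _ hPmem) hY hPmem (hE.symm (hAP a a.2)) hts).disjoint
        (hPB a ha)
    · intro a ha b hb e f he hf hsub
      have h1 : ∀ a ∈ A, ∀ e, e = Y ∨ e = P →
          a • e ∈ translates G Y ∧ SameOrigin (translates G Y) Y (a • e) := by
        rintro a ha e (rfl | rfl)
        · exact ⟨smul_mem_translates _ hY, ha⟩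
        · exact ⟨smul_mem_translates _ hPmem, hAP a ha⟩
      obtain ⟨hem, hes⟩ := h1 a ha e he
      obtain ⟨hfm, hfs⟩ := h1 b hb f hf
      rcases hE.trans hem hY hfm (hE.symm hes) hfs with h | h
      · rw [← h] at hsub
        obtain ⟨x, hx⟩ := hE.compl_nonempty hem
        exact hx (hsub hx)
      · exact h.1.not_subset (Set.compl_subset_comm.1 hsub)
  · rw [← MonoidHom.range_eq_top]
    set M := (HNNExtension.lift A.subtype t ht).range with hM
    have hAM : A ≤ M := fun a ha => ⟨HNNExtension.of ⟨a, ha⟩, by rw [HNNExtension.lift_of]; rfl⟩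
    have htM : t ∈ M := ⟨HNNExtension.t, HNNExtension.lift_t ..⟩
    have key : ∀ f ∈ translates G Y, SameOrigin (translates G Y) Y f →
        ∃ m ∈ M, f = m • Y ∨ f = m • Yᶜ := by
      rintro f ⟨g, rfl | rfl⟩ hs
      · exact ⟨g, hAM hs, Or.inl rfl⟩
      · refine ⟨g, ?_, Or.inr rfl⟩
        have h := hts.smul (g * t⁻¹)
        have h2 : (g * t⁻¹) • P = g • Yᶜ := by rw [hP, mul_smul, inv_smul_smul]
        rw [h2] at h
        have h3 : g * t⁻¹ ∈ A := hE.trans hY (smul_mem_translates _ compl_self_mem_translates)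
          (smul_mem_translates _ hY) hs (hE.symm h)
        simpa using M.mul_mem (hAM h3) htM
    refine eq_top_of_star_mem hE hinv (hLA.trans hAM) fun e he f hf hs => ?_
    rcases he with rfl | rfl
    · exact key f hf hs
    · obtain ⟨m, hm, h⟩ := key (t • f) (smul_mem_translates _ hf)
        (hE.trans hY hPmem (smul_mem_translates _ hf) hts (hs.smul t))
      refine ⟨t⁻¹ * m, M.mul_mem (M.inv_mem htM) hm, ?_⟩
      simpa only [mul_smul, eq_inv_smul_iff] using h

/-- A group acting without inversions on the tree dual to a nested family of translates of a
single set splits over the stabilizer of that set. -/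
theorem splitsOver_stabilizer (hE : IsTreeSet (translates G Y))
    (hinv : ∀ g : G, g • Y ≠ Yᶜ) (hlt : ∃ e ∈ translates G Y, e ⊂ Y)
    (hgt : ∃ e ∈ translates G Y, Y ⊂ e) : SplitsOver (MulAction.stabilizer G Y) := by
  by_cases h : ∃ t : G, SameOrigin (translates G Y) Y (t • Yᶜ)
  · obtain ⟨t, ht⟩ := h
    exact Or.inr (isHNNExtensionOver_stabilizer hE hinv ht)
  · exact Or.inl (isNontrivialAmalgamOver_stabilizer hE hinv hlt hgt (not_exists.1 h))

end Splitting

/-! ### Almost malnormality and nestedness of translates -/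

section Nested

variable {G : Type*} [Group G] {H K : Subgroup G} {U V X Y : Set G}

theorem isTreeSet_translates {α : Type*} [MulAction G α] {Y : Set α} (hY : Y.Nonempty)
    (hYc : Yᶜ.Nonempty)
    (hnest : ∀ g : G, Y ⊆ g • Y ∨ Y ⊆ (g • Y)ᶜ ∨ Yᶜ ⊆ g • Y ∨ Yᶜ ⊆ (g • Y)ᶜ)
    (hfin : ∀ x y : α, {e | ∃ g : G, e = g • Y ∧ x ∈ e ∧ y ∉ e}.Finite) :
    IsTreeSet (translates G Y) where
  compl_mem _ := compl_mem_translates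
  nonempty := by
    rintro e ⟨g, rfl | rfl⟩
    · exact hY.smul_set
    · exact hYc.smul_set
  nested := by
    have h : ∀ a b : G, a • Y ⊆ b • Y ∨ a • Y ⊆ (b • Y)ᶜ ∨ (a • Y)ᶜ ⊆ b • Y ∨
        (a • Y)ᶜ ⊆ (b • Y)ᶜ := by
      intro a b
      have h := hnest (a⁻¹ * b)
      rw [mul_smul] at h
      simp only [← Set.smul_set_compl, Set.smul_set_subset_iff_subset_inv_smul_set] at h ⊢
      exact h
    rintro e ⟨a, rfl | rfl⟩ f ⟨b, rfl | rfl⟩ <;> have := h a b <;>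
      (try simp only [Set.smul_set_compl, compl_compl]) <;> tauto
  finite x y := by
    refine ((hfin x y).union ((hfin y x).image compl)).subset ?_
    rintro e ⟨⟨g, rfl | rfl⟩, hx, hy⟩
    · exact Or.inl ⟨g, rfl, hx, hy⟩
    · refine Or.inr ⟨g • Y, ⟨g, rfl, ?_, ?_⟩, (Set.smul_set_compl ..).symm⟩
      · rw [Set.smul_set_compl] at hy
        exact not_not.1 hy
      · rw [Set.smul_set_compl] at hx
        exact hx

/-- It suffices that `gH ∩ Hf` is finite for each `f`. Two of its points `gh`, `gh₀` have quotient
`gh(gh₀)⁻¹` in the intersection of `H` with its conjugate by `gh₀`, which is finite because `gh₀ ∉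
H`. -/
theorem AlmostMalnormal.finite_preimage (hmal : AlmostMalnormal H) {g : G} (hg : g ∉ H)
    (hX : IsHFinite H X) : {h : G | h ∈ H ∧ g * h ∈ X}.Finite := by
  obtain ⟨F, hF, hXF⟩ := hX
  refine (hF.biUnion (t := fun f => {h : G | h ∈ H ∧ g * h * f⁻¹ ∈ H}) fun f _ => ?_).subset ?_
  · rcases Set.eq_empty_or_nonempty {h : G | h ∈ H ∧ g * h * f⁻¹ ∈ H} with he | ⟨h₀, h₀H, hgh₀⟩
    · rw [he]; exact Set.finite_empty
    · have hx : g * h₀ ∉ H := fun h => hg ((H.mul_mem_cancel_right h₀H).1 h)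
      have hfin := Set.not_infinite.1 (mt (hmal (g * h₀)) hx)
      refine (hfin.image fun y => h₀ * ((g * h₀)⁻¹ * y * (g * h₀))).subset ?_
      rintro h ⟨hH, hgh⟩
      refine ⟨g * h₀ * (h₀⁻¹ * h) * (g * h₀)⁻¹, ⟨?_, ?_⟩, by group⟩
      · exact ⟨h₀⁻¹ * h, H.mul_mem (H.inv_mem h₀H) hH, rfl⟩
      · have := H.mul_mem hgh (H.inv_mem hgh₀)
        rwa [show g * h * f⁻¹ * (g * h₀ * f⁻¹)⁻¹ = g * h₀ * (h₀⁻¹ * h) * (g * h₀)⁻¹ by group]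
          at this
  · rintro h ⟨hH, hgh⟩
    obtain ⟨k, hk, f, hf, hkf⟩ := hXF hgh
    refine Set.mem_biUnion hf ⟨hH, ?_⟩
    rw [← hkf]
    simpa using hk

/-- `X` is a union of left cosets of `H`. -/
def RightInvariant (H : Subgroup G) (X : Set G) : Prop := ∀ x, ∀ h ∈ H, x * h ∈ X ↔ x ∈ X

theorem RightInvariant.compl (hX : RightInvariant H X) : RightInvariant H Xᶜ :=
  fun x h hh => not_congr (hX x h hh)

theorem RightInvariant.smul (hX : RightInvariant H X) (g : G) : RightInvariant H (g • X) :=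
  fun x h hh => by
    simp only [Set.mem_smul_set_iff_inv_smul_mem, smul_eq_mul, ← mul_assoc]
    exact hX _ h hh

theorem RightInvariant.inter (hX : RightInvariant H X) (hY : RightInvariant H Y) :
    RightInvariant H (X ∩ Y) := fun x h hh => and_congr (hX x h hh) (hY x h hh)

theorem RightInvariant.not_finite (hX : RightInvariant H X) (hH : (H : Set G).Infinite)
    (hne : X.Nonempty) : ¬ X.Finite := by
  obtain ⟨x, hx⟩ := hne
  intro hfin
  refine hH.image (f := fun h => x * h) (mul_right_injective x).injOn (hfin.subset ?_)
  rintro _ ⟨h, hh, rfl⟩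
  exact (hX x h hh).2 hx

/-- Let `x = hf` be a point of the intersection. Then `g⁻¹h ∉ V`, since `g⁻¹ ∉ V` and `VH = V`,
while `g⁻¹hf ∈ V`. So `g⁻¹h` lies in the `H`-finite set `flipSet V f`, which the coset `g⁻¹H` meets
in a finite set. -/
theorem AlmostMalnormal.finite_inter_smul (hmal : AlmostMalnormal H) {g : G} (hg : g ∉ H)
    (hV : RightInvariant H V) (hVa : IsAlmostInvariant H V) (hgV : g⁻¹ ∉ V)
    (hX : IsHFinite H X) : (X ∩ g • V).Finite := by
  obtain ⟨F, hF, hXF⟩ := hX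
  have hg' : g⁻¹ ∉ H := mt H.inv_mem_iff.1 hg
  refine (hF.biUnion fun f _ => (hmal.finite_preimage hg' (hVa f)).image fun h => h * f).subset ?_
  rintro x ⟨hx, hxV⟩
  obtain ⟨h, hh, f, hf, rfl⟩ := hXF hx
  rw [Set.mem_smul_set_iff_inv_smul_mem, smul_eq_mul] at hxV
  refine Set.mem_biUnion hf ⟨h, ⟨hh, fun hiff => hgV ?_⟩, rfl⟩
  rw [← hV g⁻¹ h hh]
  exact hiff.2 (by simpa [mul_assoc] using hxV)

/-- Where the corner changes, either `U` changes at a point with an endpoint in `gV`, or `gV`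
changes at a point with an endpoint in `U`. Both cases are finite by
`AlmostMalnormal.finite_inter_smul`, the second after translation by `g⁻¹`. -/
theorem AlmostMalnormal.finite_flipSet_inter (hmal : AlmostMalnormal H) {g : G} (hg : g ∉ H)
    (hU : RightInvariant H U) (hUa : IsAlmostInvariant H U) (hgU : g ∉ U)
    (hV : RightInvariant H V) (hVa : IsAlmostInvariant H V) (hgV : g⁻¹ ∉ V) (s : G) :
    (flipSet (U ∩ g • V) s).Finite := by
  have hg' : g⁻¹ ∉ H := mt H.inv_mem_iff.1 hg
  have h1 := fun X hX => hmal.finite_inter_smul (X := X) hg hV hVa hgV hX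
  have h2 := fun X hX => hmal.finite_inter_smul (X := X) hg' hU hUa (by rwa [inv_inv]) hX
  have hs := Set.finite_singleton s
  have hs' := Set.finite_singleton s⁻¹
  refine (((h1 _ (hUa s)).union ((h1 _ ((hUa s).mul_finite hs)).mul hs')).union
    (((h2 _ (hVa s)).union ((h2 _ ((hVa s).mul_finite hs)).mul hs')).image (g * ·))).subset ?_
  intro x hx
  have mem1 : x ∈ flipSet U s → x * s ∈ g • V →
      x ∈ (flipSet U s * {s} ∩ g • V) * {s⁻¹} := fun h h' =>
    ⟨x * s, ⟨⟨x, h, s, rfl, rfl⟩, h'⟩, s⁻¹, rfl, mul_inv_cancel_right x s⟩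
  have mem2 : g⁻¹ * x ∈ flipSet V s → x * s ∈ U →
      g⁻¹ * x ∈ (flipSet V s * {s} ∩ g⁻¹ • U) * {s⁻¹} := fun h h' =>
    ⟨g⁻¹ * x * s, ⟨⟨g⁻¹ * x, h, s, rfl, rfl⟩, by
      rw [mul_assoc, Set.mem_smul_set_iff_inv_smul_mem, smul_eq_mul, inv_mul_cancel_left]
      exact h'⟩, s⁻¹, rfl, mul_inv_cancel_right _ s⟩
  have hmem : ∀ y, y ∈ g • V ↔ g⁻¹ * y ∈ V := fun y => by
    rw [Set.mem_smul_set_iff_inv_smul_mem, smul_eq_mul]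
  have himg : ∀ W : Set G, g⁻¹ * x ∈ W → x ∈ (g * ·) '' W := fun W h =>
    ⟨g⁻¹ * x, h, mul_inv_cancel_left g x⟩
  have hU' : x ∈ U → g⁻¹ * x ∈ g⁻¹ • U := fun h => ⟨x, h, rfl⟩
  have e1 : x ∈ flipSet U s ↔ ¬ (x ∈ U ↔ x * s ∈ U) := Iff.rfl
  have e2 : g⁻¹ * x ∈ flipSet V s ↔ ¬ (x ∈ g • V ↔ x * s ∈ g • V) := by
    rw [hmem, hmem, ← mul_assoc]; rfl
  have hx' : ¬ ((x ∈ U ∧ x ∈ g • V) ↔ (x * s ∈ U ∧ x * s ∈ g • V)) := hx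
  by_cases hc1 : x ∈ flipSet U s ∧ (x ∈ g • V ∨ x * s ∈ g • V)
  · refine Or.inl ?_
    rcases hc1 with ⟨h, h' | h'⟩
    · exact Or.inl ⟨h, h'⟩
    · exact Or.inr (mem1 h h')
  · have hc2 : g⁻¹ * x ∈ flipSet V s ∧ (x ∈ U ∨ x * s ∈ U) := by
      have taut : ∀ p q r t : Prop, ¬ ((p ∧ q) ↔ (r ∧ t)) → ¬ (¬ (p ↔ r) ∧ (q ∨ t)) →
          ¬ (q ↔ t) ∧ (p ∨ r) := by grind
      rw [e1] at hc1
      rw [e2]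
      exact taut _ _ _ _ hx' hc1
    refine Or.inr (himg _ ?_)
    rcases hc2 with ⟨h, h' | h'⟩
    · exact Or.inl ⟨h, hU' h'⟩
    · exact Or.inr (mem2 h h')

theorem AlmostMalnormal.inter_smul_eq_empty (hmal : AlmostMalnormal H) (heG : numEnds G = 1)
    (hH : (H : Set G).Infinite) {g : G} (hg : g ∉ H)
    (hU : RightInvariant H U) (hUa : IsAlmostInvariant H U) (hgU : g ∉ U)
    (hV : RightInvariant H V) (hVa : IsAlmostInvariant H V) (hgV : g⁻¹ ∉ V) :
    U ∩ g • V = ∅ := by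
  by_contra hne
  have hinv := hU.inter (hV.smul g)
  rcases finite_or_finite_compl_of_numEnds_eq_one heG (X := U ∩ g • V) fun s =>
    IsHFinite.of_finite (hmal.finite_flipSet_inter hg hU hUa hgU hV hVa hgV s) with h | h
  · exact hinv.not_finite hH (Set.nonempty_iff_ne_empty.2 hne) h
  · exact hinv.compl.not_finite hH ⟨g, fun h => hgU h.1⟩ h

/-- For `g ∉ H` the membership of `g` and `g⁻¹` in `Y` decides which of the four corners of `Y` and
`gY` is empty. Almost invariance relative to the stabilizer of `Y`, not just to `H`, makes the dual
tree locally finite between points. -/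
theorem exists_splitsOver_of_rightInvariant (heG : numEnds G = 1) (hH : (H : Set G).Infinite)
    (hmal : AlmostMalnormal H) (hY : RightInvariant H Y) (hYH : Disjoint (H : Set G) Y)
    (hne : Y.Nonempty) (hout : ∃ g, g ∉ Y ∧ g ∉ H)
    (hHY : ∀ h ∈ H, h • Y = Y ∨ Disjoint Y (h • Y))
    (hYa : IsAlmostInvariant (MulAction.stabilizer G Y ⊓ H) Y) :
    ∃ K : Subgroup G, K ≤ H ∧ SplitsOver K := by
  set L := MulAction.stabilizer G Y with hL
  have hYaH : IsAlmostInvariant H Y := fun s => (hYa s).of_le inf_le_right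
  have h1Y : (1 : G) ∉ Y := fun h => Set.disjoint_left.1 hYH H.one_mem h
  have hYc : Yᶜ.Nonempty := ⟨1, h1Y⟩
  have hnn : ∀ g ∉ H, g ∉ Y → g⁻¹ ∉ Y → Y ⊆ (g • Y)ᶜ := fun g hg h h' =>
    Set.disjoint_left.1 (Set.disjoint_iff_inter_eq_empty.2
      (hmal.inter_smul_eq_empty heG hH hg hY hYaH h hY hYaH h'))
  have hnp : ∀ g ∉ H, g ∉ Y → g⁻¹ ∈ Y → Y ⊆ g • Y := fun g hg h h' => by
    have := Set.disjoint_left.1 (Set.disjoint_iff_inter_eq_empty.2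
      (hmal.inter_smul_eq_empty heG hH hg hY hYaH h hY.compl hYaH.compl (not_not.2 h')))
    intro x hx
    have := this hx
    rwa [Set.smul_set_compl, Set.notMem_compl_iff] at this
  have hpn : ∀ g ∉ H, g ∈ Y → g⁻¹ ∉ Y → g • Y ⊆ Y := fun g hg h h' => by
    have := hmal.inter_smul_eq_empty heG hH hg hY.compl hYaH.compl (not_not.2 h) hY hYaH h'
    rw [Set.inter_comm, ← Set.disjoint_iff_inter_eq_empty, Set.disjoint_compl_right_iff_subset]
      at this
    exact this
  have hpp : ∀ g ∉ H, g ∈ Y → g⁻¹ ∈ Y → Yᶜ ⊆ g • Y := fun g hg h h' => by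
    have := Set.disjoint_left.1 (Set.disjoint_iff_inter_eq_empty.2
      (hmal.inter_smul_eq_empty heG hH hg hY.compl hYaH.compl (not_not.2 h)
        hY.compl hYaH.compl (not_not.2 h')))
    intro x hx
    have := this hx
    rwa [Set.smul_set_compl, Set.notMem_compl_iff] at this
  have hLH : L ≤ H := by
    intro g hg
    rw [hL, MulAction.mem_stabilizer_iff] at hg
    by_contra hgH
    have h1 : g ∉ Y := fun h => h1Y <| by
      rw [← hg, Set.mem_smul_set_iff_inv_smul_mem] at h
      simpa using h
    have h2 : g⁻¹ ∉ Y := fun h => h1Y <| by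
      rw [← hg, Set.mem_smul_set_iff_inv_smul_mem.trans (Iff.rfl), smul_eq_mul, mul_one]
      exact h
    have := hnn g hgH h1 h2
    rw [hg] at this
    obtain ⟨x, hx⟩ := hne
    exact this hx hx
  -- Otherwise `Y` would be almost invariant relative to the trivial subgroup, hence finite or
  -- cofinite, while `Y` and its complement are nonempty unions of infinite cosets.
  have hLinf : (L : Set G).Infinite := by
    intro hLfin
    rcases finite_or_finite_compl_of_numEnds_eq_one heG (X := Y) fun s =>
      IsHFinite.of_finite ((hYa s).finite (hLfin.subset inf_le_left)) with h | h
    · exact hY.not_finite hH hne h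
    · exact hY.compl.not_finite hH hYc h
  have hinv : ∀ g : G, g • Y ≠ Yᶜ := by
    intro g hg
    have hgc : g • Yᶜ = Y := by rw [Set.smul_set_compl, hg, compl_compl]
    -- An element exchanging `Y` and `Yᶜ` normalizes `L`, so `gHg⁻¹ ∩ H` contains the infinite group
    -- `L`.
    have hgH : g ∈ H := by
      refine hmal g (hLinf.mono fun l hl => ⟨?_, hLH hl⟩)
      refine ⟨g⁻¹ * l * g, hLH ?_, by simp [MulAut.smul_def, mul_assoc]⟩
      have hl' : l • Y = Y := hl
      rw [hL, MulAction.mem_stabilizer_iff, mul_smul, mul_smul, hg, Set.smul_set_compl, hl', ← hg,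
        inv_smul_smul]
    have h1 : (1 : G) ∈ g • Y := hg ▸ h1Y
    rw [Set.mem_smul_set_iff_inv_smul_mem, smul_eq_mul, mul_one] at h1
    exact Set.disjoint_left.1 hYH (H.inv_mem hgH) h1
  have hE : IsTreeSet (translates G Y) := by
    refine isTreeSet_translates hne hYc (fun g => ?_) fun x y => ?_
    · by_cases hg : g ∈ H
      · rcases hHY g hg with h | h
        · exact Or.inl h.ge
        · exact Or.inr (Or.inl (Set.disjoint_left.1 h))
      · by_cases h : g ∈ Y <;> by_cases h' : g⁻¹ ∈ Y
        · exact Or.inr (Or.inr (Or.inl (hpp g hg h h')))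
        · exact Or.inr (Or.inr (Or.inr (Set.compl_subset_compl.2 (hpn g hg h h'))))
        · exact Or.inl (hnp g hg h h')
        · exact Or.inr (Or.inl (hnn g hg h h'))
    -- If `gY` separates `x` from `y`, then `g⁻¹x = lf` with `l` fixing `Y` and `f ∈ F`, so `gY =
    -- glY = xf⁻¹Y`: at most one translate for each `f`.
    · obtain ⟨F, hF, hYF⟩ := hYa (x⁻¹ * y)
      refine (hF.image fun f => (x * f⁻¹) • Y).subset ?_
      rintro _ ⟨g, rfl, hx, hy⟩
      rw [Set.mem_smul_set_iff_inv_smul_mem, smul_eq_mul] at hx hy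
      have hflip : g⁻¹ * x ∈ flipSet Y (x⁻¹ * y) := fun h => hy (by simpa [mul_assoc] using h.1 hx)
      obtain ⟨l, hl, f, hf, hlf⟩ := hYF hflip
      refine ⟨f, hf, ?_⟩
      have hl' : l • Y = Y := hl.1
      have hg : x * f⁻¹ = g * l := by
        rw [mul_inv_eq_iff_eq_mul, mul_assoc, show l * f = g⁻¹ * x from hlf]; group
      simp only [hg, mul_smul, hl']
  have hgY : ∀ g ∉ H, g • Y ≠ Y := fun g hg h => hg (hLH h)
  refine ⟨L, hLH, splitsOver_stabilizer hE hinv ?_ ?_⟩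
  · obtain ⟨g, hg⟩ := hne
    have hgH : g ∉ H := fun h => Set.disjoint_left.1 hYH h hg
    by_cases h' : g⁻¹ ∈ Y
    · refine ⟨g • Yᶜ, ⟨g, Or.inr rfl⟩, ?_⟩
      rw [Set.smul_set_compl]
      refine (Set.compl_subset_comm.1 (hpp g hgH hg h')).ssubset_of_ne fun h =>
        hinv g (compl_eq_comm.1 h).symm
    · exact ⟨g • Y, ⟨g, Or.inl rfl⟩, (hpn g hgH hg h').ssubset_of_ne (hgY g hgH)⟩
  · obtain ⟨g, hg, hgH⟩ := hout
    by_cases h' : g⁻¹ ∈ Y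
    · exact ⟨g • Y, ⟨g, Or.inl rfl⟩, (hnp g hgH hg h').ssubset_of_ne (hgY g hgH).symm⟩
    · refine ⟨g • Yᶜ, ⟨g, Or.inr rfl⟩, ?_⟩
      rw [Set.smul_set_compl]
      exact (hnn g hgH hg h').ssubset_of_ne fun h => hinv g (compl_eq_comm.1 h.symm).symm

end Nested

/-! ### Components of the Cayley graph off a neighbourhood of `H` -/

section Components

variable {G : Type*} [Group G] {H K : Subgroup G} {C D N S X Y : Set G}

theorem flipSet_mul_subset (X : Set G) (a b : G) :
    flipSet X (a * b) ⊆ flipSet X a ∪ flipSet X b * {a⁻¹} := by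
  intro x hx
  by_cases h : x ∈ flipSet X a
  · exact Or.inl h
  · refine Or.inr ⟨x * a, fun h' => hx ?_, a⁻¹, rfl, mul_inv_cancel_right x a⟩
    rw [← mul_assoc]
    exact (not_not.1 h).trans h'

/-- Almost invariance under a generating monoid of right translations is enough. -/
theorem IsAlmostInvariant.of_closure (hS : Submonoid.closure S = ⊤)
    (h : ∀ s ∈ S, IsHFinite H (flipSet X s)) : IsAlmostInvariant H X := by
  intro g
  have hg : g ∈ Submonoid.closure S := hS ▸ Submonoid.mem_top g
  induction hg using Submonoid.closure_induction with
  | mem s hs => exact h s hs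
  | one => exact IsHFinite.of_finite (by simp [flipSet])
  | mul a b _ _ ha hb =>
    exact (ha.union (hb.mul_finite (Set.finite_singleton _))).mono (flipSet_mul_subset X a b)

/-- Sets that differ by an `H`-finite set are almost invariant together. -/
theorem IsAlmostInvariant.congr (hX : IsAlmostInvariant H X)
    (hXY : IsHFinite H {x | ¬ (x ∈ X ↔ x ∈ Y)}) : IsAlmostInvariant H Y := by
  intro g
  refine ((hX g).union (hXY.union (hXY.mul_finite (Set.finite_singleton g⁻¹)))).mono ?_
  intro x hx
  by_contra hcon
  simp only [Set.mem_union, not_or] at hcon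
  obtain ⟨h1, h2, h3⟩ := hcon
  have h3' : ¬ ¬ (x * g ∈ X ↔ x * g ∈ Y) := fun h =>
    h3 ⟨x * g, h, g⁻¹, rfl, mul_inv_cancel_right x g⟩
  exact hx ((not_not.1 h2).symm.trans ((not_not.1 h1).trans (not_not.1 h3')))

/-- Adjacency in the Cayley graph for the generators `S`, with the vertices in `N` removed. -/
def AdjOff (S N : Set G) (x y : G) : Prop := x ∉ N ∧ y ∉ N ∧ ∃ s ∈ S, y = x * s

/-- The component of `x` in the Cayley graph with the vertices in `N` removed. -/
def componentOff (S N : Set G) (x : G) : Set G := {y | Relation.ReflTransGen (AdjOff S N) x y}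

theorem mem_componentOff_self (x : G) : x ∈ componentOff S N x := Relation.ReflTransGen.refl

theorem AdjOff.symm (hS : ∀ s ∈ S, s⁻¹ ∈ S) {x y : G} (h : AdjOff S N x y) : AdjOff S N y x := by
  obtain ⟨hx, hy, s, hs, rfl⟩ := h
  exact ⟨hy, hx, s⁻¹, hS s hs, by simp⟩

theorem componentOff_eq (hS : ∀ s ∈ S, s⁻¹ ∈ S) {x y : G} (h : y ∈ componentOff S N x) :
    componentOff S N y = componentOff S N x := by
  have hsymm : Relation.ReflTransGen (AdjOff S N) y x := by
    have : Std.Symm (AdjOff S N) := ⟨fun _ _ => AdjOff.symm hS⟩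
    exact Std.Symm.symm _ _ h
  exact Set.Subset.antisymm (fun z hz => Relation.ReflTransGen.trans h hz)
    (fun z hz => Relation.ReflTransGen.trans hsymm hz)

theorem notMem_of_mem_componentOff {x y : G} (hx : x ∉ N) (h : y ∈ componentOff S N x) :
    y ∉ N := by
  induction h with
  | refl => exact hx
  | tail _ h _ => exact h.2.1

theorem smul_componentOff (hN : ∀ h ∈ H, ∀ x, h * x ∈ N ↔ x ∈ N) {h : G} (hh : h ∈ H) (x : G) :
    h • componentOff S N x = componentOff S N (h * x) := by
  have key : ∀ h ∈ H, ∀ x, h • componentOff S N x ⊆ componentOff S N (h * x) := by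
    rintro h hh x _ ⟨y, hy, rfl⟩
    refine Relation.ReflTransGen.lift (h * ·) ?_ _ _ hy
    rintro a b ⟨ha, hb, s, hs, rfl⟩
    exact ⟨fun h' => ha ((hN h hh a).1 h'), fun h' => hb ((hN h hh _).1 h'), s, hs,
      (mul_assoc h a s).symm⟩
  refine (key h hh x).antisymm ?_
  rw [Set.subset_smul_set_iff]
  simpa using key h⁻¹ (H.inv_mem hh) (h * x)

theorem componentOff_subset (hXN : ∀ s ∈ S, flipSet X s ⊆ N) {x : G} (hx : x ∈ X) :
    componentOff S N x ⊆ X := by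
  intro y hy
  induction hy with
  | refl => exact hx
  | @tail a b _ h ih =>
    obtain ⟨ha, hb, s, hs, rfl⟩ := h
    exact (not_not.1 fun h => ha (hXN s hs h)).1 ih

/-- A component with no neighbour in `N` would be closed under right multiplication by all of `G`,
and so would contain `n`. -/
theorem exists_mul_mem_of_componentOff (hS : Submonoid.closure S = ⊤) {n : G} (hn : n ∈ N) {x : G}
    (hx : x ∉ N) : ∃ y ∈ componentOff S N x, ∃ s ∈ S, y * s ∈ N := by
  by_contra! hcon
  have hall : ∀ g : G, ∀ y ∈ componentOff S N x, y * g ∈ componentOff S N x := by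
    intro g
    have hg : g ∈ Submonoid.closure S := hS ▸ Submonoid.mem_top g
    induction hg using Submonoid.closure_induction with
    | mem s hs =>
      intro y hy
      exact Relation.ReflTransGen.tail hy
        ⟨notMem_of_mem_componentOff hx hy, hcon y hy s hs, s, hs, rfl⟩
    | one => simp
    | mul a b _ _ ha hb => intro y hy; rw [← mul_assoc]; exact hb _ (ha _ hy)
  have := hall (x⁻¹ * n) x (mem_componentOff_self x)
  rw [mul_inv_cancel_left] at this
  exact notMem_of_mem_componentOff hx this hn

theorem mul_mem_subgroup_mul_iff {B : Set G} :
    ∀ h ∈ H, ∀ x, h * x ∈ (H : Set G) * B ↔ x ∈ (H : Set G) * B := by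
  refine fun h hh x => ⟨?_, ?_⟩
  · rintro ⟨k, hk, b, hb, hkb⟩
    exact ⟨h⁻¹ * k, H.mul_mem (H.inv_mem hh) hk, b, hb, by
      simp only [mul_assoc, show k * b = h * x from hkb, inv_mul_cancel_left]⟩
  · rintro ⟨k, hk, b, hb, rfl⟩
    exact ⟨h * k, H.mul_mem hh hk, b, hb, mul_assoc h k b⟩

/-- Removing an `H`-finite neighbourhood of `H` from the Cayley graph leaves only finitely many
`H`-orbits of components, so some component inside a given non-`H`-finite almost invariant set is
not `H`-finite. -/
theorem exists_componentOff_not_isHFinite (hSfin : S.Finite) (hS : Submonoid.closure S = ⊤)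
    (hSinv : ∀ s ∈ S, s⁻¹ ∈ S) {B : Set G} (hB : B.Finite) (h1B : (1 : G) ∈ B)
    (hX : ¬ IsHFinite H X) :
    ∃ x ∈ X, x ∉ (H : Set G) * B ∧ ¬ IsHFinite H (componentOff S ((H : Set G) * B) x) := by
  set N := (H : Set G) * B with hN
  have hNH : ∀ h ∈ H, ∀ x, h * x ∈ N ↔ x ∈ N := mul_mem_subgroup_mul_iff
  by_contra! hcon
  refine hX ?_
  have hNfin : IsHFinite H N := ⟨B, hB, subset_rfl⟩
  -- Every component is adjacent to `N = HB`, so some `H`-translate of it passes through the finite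
  -- set `B * S⁻¹`.
  have hF : ((B * S⁻¹) ∩ {c | IsHFinite H (componentOff S N c)}).Finite :=
    (hB.mul hSfin.inv).inter_of_left _
  refine (hNfin.union (IsHFinite.biUnion hF fun c hc => hc.2.subgroup_mul)).mono fun x hx => ?_
  by_cases hxN : x ∈ N
  · exact Or.inl hxN
  right
  obtain ⟨y, hy, s, hs, h, hh, b, hb, hys⟩ := exists_mul_mem_of_componentOff hS
    (show (1 : G) ∈ N from ⟨1, H.one_mem, 1, h1B, one_mul 1⟩) hxN
  have hy' : y = h * (b * s⁻¹) := by
    rw [← mul_assoc, show h * b = y * s from hys, mul_inv_cancel_right]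
  have hcomp : h • componentOff S N (b * s⁻¹) = componentOff S N x := by
    rw [smul_componentOff hNH hh, ← hy', componentOff_eq hSinv hy]
  refine Set.mem_biUnion (x := b * s⁻¹) ⟨⟨b, hb, s⁻¹, Set.inv_mem_inv.2 hs, rfl⟩, ?_⟩ ?_
  · have h2 : componentOff S N (b * s⁻¹) = h⁻¹ • componentOff S N x := by
      rw [← hcomp, inv_smul_smul]
    refine ((hcon x hx hxN).subgroup_mul).mono ?_
    rw [h2]
    rintro _ ⟨z, hz, rfl⟩
    exact ⟨h⁻¹, H.inv_mem hh, z, hz, rfl⟩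
  · have hxm : x ∈ h • componentOff S N (b * s⁻¹) := hcomp ▸ mem_componentOff_self x
    obtain ⟨z, hz, rfl⟩ := hxm
    exact ⟨h, hh, z, hz, rfl⟩

/-- An `H`-finite subset of `C` is finite relative to the stabilizer of `C` in `H`, provided the
`H`-translates of `C` are disjoint. -/
theorem IsHFinite.inf_stabilizer (hC : ∀ h ∈ H, h • C = C ∨ Disjoint C (h • C))
    (hX : IsHFinite H X) (hXC : X ⊆ C) : IsHFinite (MulAction.stabilizer G C ⊓ H) X := by
  obtain ⟨F, hF, hXF⟩ := hX
  -- Each coset representative `f` is moved into `X` whenever `X` meets `Hf`. The element of `H`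
  -- relating two points of `X ⊆ C` then maps a point of `C` into `C`, so it stabilizes `C`.
  have hsel : ∀ f : G, ∃ y, ∀ x ∈ X, x * f⁻¹ ∈ H → y ∈ X ∧ y * f⁻¹ ∈ H := by
    intro f
    by_cases h : ∃ y ∈ X, y * f⁻¹ ∈ H
    · obtain ⟨y, hy⟩ := h
      exact ⟨y, fun _ _ _ => hy⟩
    · exact ⟨1, fun x hx hxf => absurd ⟨x, hx, hxf⟩ h⟩
  choose r hr using hsel
  refine ⟨r '' F, hF.image r, fun x hx => ?_⟩
  obtain ⟨h, hh, f, hf, hhf⟩ := hXF hx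
  have hxf : x * f⁻¹ ∈ H := by
    rw [← hhf]
    simpa using hh
  obtain ⟨hrX, hrf⟩ := hr f x hx hxf
  have hk : x * (r f)⁻¹ ∈ H := by
    have := H.mul_mem hxf (H.inv_mem hrf)
    rwa [show x * f⁻¹ * (r f * f⁻¹)⁻¹ = x * (r f)⁻¹ by group] at this
  refine ⟨x * (r f)⁻¹, ⟨?_, hk⟩, r f, ⟨f, hf, rfl⟩, inv_mul_cancel_right x _⟩
  refine (hC _ hk).resolve_right fun hd => Set.disjoint_left.1 hd (hXC hx) ?_
  exact ⟨r f, hXC hrX, inv_mul_cancel_right x _⟩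

/-- A subset that does not absorb `H` on the right is left by a single generator. -/
theorem exists_mul_mem_notMem_of_closure {T : Set G} (hT : Submonoid.closure T = H.toSubmonoid)
    {x h : G} (hx : x ∈ C) (hh : h ∈ H) (hxh : x * h ∉ C) :
    ∃ k ∈ H, ∃ t ∈ T, x * k ∈ C ∧ x * k * t ∉ C := by
  by_contra! hcon
  have hTH : ∀ g ∈ Submonoid.closure T, g ∈ H := fun g hg => by rw [hT] at hg; exact hg
  have hall : ∀ g ∈ Submonoid.closure T, ∀ k ∈ H, x * k ∈ C → x * k * g ∈ C := by
    intro g hg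
    induction hg using Submonoid.closure_induction with
    | mem t ht => exact fun k hk h => hcon k hk t ht h
    | one => simp
    | mul a b ha _ iha ihb =>
      intro k hk h
      have := ihb (k * a) (H.mul_mem hk (hTH a ha)) (by rw [← mul_assoc]; exact iha k hk h)
      simpa [mul_assoc] using this
  have hh' : h ∈ Submonoid.closure T := by rw [hT]; exact hh
  exact hxh (by simpa using hall h hh' 1 H.one_mem (by simpa using hx))

end Components

/-! ### Cosets of `H` lying mostly on one side of a component -/

section Sides

variable {G : Type*} [Group G] {H K : Subgroup G} {C : Set G}

theorem infinite_of_numEnds_subgroup (heH : numEnds H = 1) : (H : Set G).Infinite :=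
  Set.infinite_coe_iff.1 (infinite_of_numEnds_eq_one heH)

/-- If `H` is one-ended and almost malnormal then all other left cosets `gH` lie, up to finite
sets, on one side of an `H`-almost invariant set. -/
theorem AlmostMalnormal.finite_or_finite (hmal : AlmostMalnormal H) (heH : numEnds H = 1)
    (hC : IsAlmostInvariant H C) {g : G} (hg : g ∉ H) :
    {h | h ∈ H ∧ g * h ∈ C}.Finite ∨ {h | h ∈ H ∧ g * h ∉ C}.Finite := by
  have hZ : IsAlmostInvariant ⊥ {h : H | g * h ∈ C} := fun t => by
    refine IsHFinite.of_finite (((hmal.finite_preimage hg (hC t)).preimage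
      (Subtype.val_injective (p := (· ∈ H))).injOn).subset fun h hh => ⟨h.2, ?_⟩)
    simpa [flipSet, mul_assoc] using hh
  refine (finite_or_finite_compl_of_numEnds_eq_one heH hZ).imp (fun h => ?_) fun h => ?_
  all_goals
    refine (h.image Subtype.val).subset ?_
    rintro x ⟨hx, hgx⟩
    exact ⟨⟨x, hx⟩, hgx, rfl⟩

/-- The set of `g` such that most of the coset `gH` lies in `C`. -/
def cosetsInside (H : Subgroup G) (C : Set G) : Set G := {g | {h | h ∈ H ∧ g * h ∈ C}.Infinite}

theorem rightInvariant_cosetsInside : RightInvariant H (cosetsInside H C) := by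
  have key : ∀ x, ∀ k ∈ H, x ∈ cosetsInside H C → x * k ∈ cosetsInside H C := by
    intro x k hk hx hfin
    refine hx ((hfin.image (k * ·)).subset ?_)
    rintro h ⟨hh, hxh⟩
    exact ⟨k⁻¹ * h, ⟨H.mul_mem (H.inv_mem hk) hh, by simpa [mul_assoc] using hxh⟩, by simp⟩
  refine fun x h hh => ⟨fun hx => ?_, key x h hh⟩
  simpa using key _ h⁻¹ (H.inv_mem hh) hx

theorem smul_cosetsInside (g : G) : g • cosetsInside H C = cosetsInside H (g • C) := by
  ext x
  simp only [Set.mem_smul_set_iff_inv_smul_mem, smul_eq_mul, cosetsInside, mul_assoc,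
    Set.mem_ofPred_eq]

theorem disjoint_cosetsInside (hCH : Disjoint (H : Set G) C) :
    Disjoint (H : Set G) (cosetsInside H C) := by
  refine Set.disjoint_left.2 fun g hg hgC => ?_
  obtain ⟨h, hh, hgh⟩ := Set.Infinite.nonempty hgC
  exact Set.disjoint_left.1 hCH (H.mul_mem hg hh) hgh

/-- If `C` and `hC` are disjoint, a coset with almost all its points in `C` has only finitely many
in `hC`. -/
theorem cosetsInside_eq_or_disjoint (hmal : AlmostMalnormal H) (heH : numEnds H = 1)
    (hCa : IsAlmostInvariant H C) (hCH : Disjoint (H : Set G) C)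
    (hC : ∀ h ∈ H, h • C = C ∨ Disjoint C (h • C)) {h : G} (hh : h ∈ H) :
    h • cosetsInside H C = cosetsInside H C ∨
      Disjoint (cosetsInside H C) (h • cosetsInside H C) := by
  rcases hC h hh with h' | h'
  · left
    rw [smul_cosetsInside, h']
  · right
    rw [smul_cosetsInside]
    refine Set.disjoint_left.2 fun g hg hgC => hgC ?_
    have hgH : g ∉ H := fun hgH => Set.disjoint_left.1 (disjoint_cosetsInside hCH) hgH hg
    refine ((hmal.finite_or_finite heH hCa hgH).resolve_left hg).subset ?_
    rintro k ⟨hk, hgk⟩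
    exact ⟨hk, fun h => Set.disjoint_left.1 h' h hgk⟩

/-- A component `C` and the union of the cosets mostly inside it differ by a set that is finite
relative to the stabilizer of `C`. -/
theorem isHFinite_cosetsInside_symmDiff (hmal : AlmostMalnormal H) (heH : numEnds H = 1)
    (hCa : IsAlmostInvariant H C) (hCH : Disjoint (H : Set G) C)
    (hK : ∀ k ∈ K, k • C = C) {T : Set G}
    (hT : Submonoid.closure T = H.toSubmonoid)
    (hbd : IsHFinite K {x | x ∈ C ∧ ∃ t ∈ T, x * t ∉ C}) :
    IsHFinite K {x | ¬ (x ∈ C ↔ x ∈ cosetsInside H C)} := by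
  set Y := cosetsInside H C with hY
  set D : Set G := {x | ¬ (x ∈ C ↔ x ∈ Y)} with hD
  have hHinf : (H : Set G).Infinite := infinite_of_numEnds_subgroup heH
  have hYH := disjoint_cosetsInside hCH
  obtain ⟨F, hF, hbF⟩ := hbd
  have hDH : ∀ x ∈ D, x ∉ H := fun x hx hxH => hx
    (iff_of_false (Set.disjoint_left.1 hCH hxH) (Set.disjoint_left.1 hYH hxH))
  -- Each coset `xH` is wholly inside or wholly outside `Y`, so its points in `D` are the finitely
  -- many on the minority side of `C`.
  have hcoset : ∀ x, {h | h ∈ H ∧ x * h ∈ D}.Finite := by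
    intro x
    by_cases hxH : x ∈ H
    · convert Set.finite_empty
      ext h
      simp only [Set.mem_ofPred_eq, Set.mem_empty_iff_false, iff_false]
      exact fun h' => hDH _ h'.2 (H.mul_mem hxH h'.1)
    by_cases hxY : x ∈ Y
    · refine ((hmal.finite_or_finite heH hCa hxH).resolve_left hxY).subset ?_
      rintro h ⟨hh, hxh⟩
      exact ⟨hh, fun hC => hxh (iff_of_true hC ((rightInvariant_cosetsInside x h hh).2 hxY))⟩
    · refine (Set.not_infinite.1 hxY).subset ?_
      rintro h ⟨hh, hxh⟩
      refine ⟨hh, ?_⟩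
      by_contra hC
      exact hxh (iff_of_false hC (mt (rightInvariant_cosetsInside x h hh).1 hxY))
  have hfin : (⋃ f ∈ F, (f * ·) '' {h | h ∈ H ∧ f * h ∈ D}).Finite :=
    hF.biUnion fun f _ => (hcoset f).image _
  refine ⟨_, hfin, fun x hx => ?_⟩
  -- The coset of a point of `D` contains points both inside and outside `C`, so a path in it along
  -- `T` crosses the boundary of `C`. A translation by `K`, under which `D` is invariant, then
  -- brings that coset to one of the finitely many `fH`.
  have hbdry : ∃ k ∈ H, ∃ t ∈ T, x * k ∈ C ∧ x * k * t ∉ C := by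
    by_cases hxC : x ∈ C
    · have hxY : x ∉ Y := fun h => hx (iff_of_true hxC h)
      obtain ⟨h, hh, hxh⟩ := hHinf.exists_notMem_finite (Set.not_infinite.1 hxY)
      exact exists_mul_mem_notMem_of_closure hT hxC hh fun h' => hxh ⟨hh, h'⟩
    · have hxY : x ∈ Y := by_contra fun h => hx (iff_of_false hxC h)
      obtain ⟨h, hh, hxh⟩ := Set.Infinite.nonempty hxY
      obtain ⟨k, hk, t, ht, h1, h2⟩ := exists_mul_mem_notMem_of_closure hT hxh (H.inv_mem hh)
        (by simpa using hxC)
      exact ⟨h * k, H.mul_mem hh hk, t, ht, by rwa [← mul_assoc], by rwa [← mul_assoc]⟩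
  obtain ⟨k, hk, t, ht, h1, h2⟩ := hbdry
  obtain ⟨a, ha, f, hf, haf⟩ := hbF (show x * k ∈ _ from ⟨h1, t, ht, h2⟩)
  have haf' : a⁻¹ * x = f * k⁻¹ := by
    rw [inv_mul_eq_iff_eq_mul, ← mul_assoc, show a * f = x * k from haf, mul_inv_cancel_right]
  have hac : (a⁻¹ * x ∈ C ↔ x ∈ C) ∧ (a⁻¹ * x ∈ Y ↔ x ∈ Y) := by
    have haY : a • Y = Y := by rw [hY, smul_cosetsInside, hK a ha]
    constructor
    · rw [← smul_eq_mul, ← Set.mem_smul_set_iff_inv_smul_mem, hK a ha]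
    · rw [← smul_eq_mul, ← Set.mem_smul_set_iff_inv_smul_mem, haY]
  refine ⟨a, ha, a⁻¹ * x, Set.mem_biUnion hf ⟨k⁻¹, ⟨H.inv_mem hk, ?_⟩, haf'.symm⟩,
    mul_inv_cancel_left a x⟩
  change ¬ _
  rw [← haf', hac.1, hac.2]
  exact hx

theorem Subgroup.FG.exists_symmetric_submonoid_closure (hH : H.FG) :
    ∃ T : Set G, T.Finite ∧ (∀ t ∈ T, t⁻¹ ∈ T) ∧ Submonoid.closure T = H.toSubmonoid := by
  obtain ⟨S, hS, hSfin⟩ := (Subgroup.fg_iff H).1 hH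
  refine ⟨S ∪ S⁻¹, hSfin.union hSfin.inv, ?_, ?_⟩
  · rintro t (h | h)
    · exact Or.inr (Set.inv_mem_inv.2 h)
    · exact Or.inl h
  · rw [← Subgroup.closure_toSubmonoid, hS]

end Sides

/-! ### The main theorem -/

theorem theorem3p5 {G : Type*} [Group G] (hG : Group.FG G) (H : Subgroup G) (hH : H.FG)
    (heG : numEnds G = 1) (heH : numEnds H = 1) (heGH : 2 ≤ relativeEnds H)
    (hmal : AlmostMalnormal H) :
    ∃ K : Subgroup G, K ≤ H ∧ SplitsOver K := by
  obtain ⟨X, hXa, hX, hXc⟩ := exists_almostInvariant_of_two_le heGH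
  obtain ⟨T, hTfin, hTinv, hT⟩ := hH.exists_symmetric_submonoid_closure
  obtain ⟨S₀, hS₀fin, hS₀inv, hS₀⟩ := hG.out.exists_symmetric_submonoid_closure
  -- Including generators of `H` lets the boundary of `C` in the Cayley graph control paths inside
  -- left cosets of `H`.
  let S := S₀ ∪ T
  have hSfin : S.Finite := hS₀fin.union hTfin
  have hSinv : ∀ s ∈ S, s⁻¹ ∈ S := fun s hs => hs.imp (hS₀inv s) (hTinv s)
  have hS : Submonoid.closure S = ⊤ := by
    rw [eq_top_iff, ← Subgroup.top_toSubmonoid, ← hS₀]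
    exact Submonoid.closure_mono Set.subset_union_left
  obtain ⟨B₀, hB₀, hflip⟩ := IsHFinite.biUnion hSfin fun s _ => hXa s
  -- Adding `1` ensures `H ⊆ N`, so that `C` is disjoint from `H`.
  set B := insert 1 B₀ with hBdef
  have hB : B.Finite := hB₀.insert 1
  set N := (H : Set G) * B with hN
  have hXN : ∀ s ∈ S, flipSet X s ⊆ N := fun s hs =>
    ((Set.subset_biUnion_of_mem (u := fun s => flipSet X s) hs).trans hflip).trans
      (Set.mul_subset_mul_left (Set.subset_insert _ _))
  have hHN : (H : Set G) ⊆ N := fun h hh => ⟨h, hh, 1, Set.mem_insert _ _, mul_one h⟩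
  have hNH : ∀ h ∈ H, ∀ x, h * x ∈ N ↔ x ∈ N := mul_mem_subgroup_mul_iff
  obtain ⟨c, hcX, hcN, hc⟩ :=
    exists_componentOff_not_isHFinite hSfin hS hSinv hB (Set.mem_insert _ _) hX
  set C := componentOff S N c with hCdef
  have hCX : C ⊆ X := componentOff_subset hXN hcX
  have hCN : ∀ x ∈ C, x ∉ N := fun x hx => notMem_of_mem_componentOff hcN hx
  have hCH : Disjoint (H : Set G) C := Set.disjoint_left.2 fun x hx hxC => hCN x hxC (hHN hx)
  have hCorb : ∀ h ∈ H, h • C = C ∨ Disjoint C (h • C) := by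
    intro h hh
    rw [or_iff_not_imp_right, Set.not_disjoint_iff]
    rintro ⟨y, hy, hyh⟩
    rw [hCdef, smul_componentOff hNH hh] at hyh ⊢
    rw [← componentOff_eq hSinv hyh, componentOff_eq hSinv hy]
  set K := MulAction.stabilizer G C ⊓ H with hKdef
  have hbd : IsHFinite K {x | x ∈ C ∧ ∃ s ∈ S, x * s ∉ C} := by
    refine IsHFinite.inf_stabilizer hCorb ?_ fun x hx => hx.1
    refine IsHFinite.mono ((show IsHFinite H N from ⟨B, hB, subset_rfl⟩).mul_finite hSfin.inv) ?_
    rintro x ⟨hx, s, hs, hxs⟩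
    refine ⟨x * s, ?_, s⁻¹, Set.inv_mem_inv.2 hs, mul_inv_cancel_right x s⟩
    by_contra hN'
    exact hxs (Relation.ReflTransGen.tail hx ⟨hCN x hx, hN', s, hs, rfl⟩)
  have hCa : IsAlmostInvariant K C := by
    refine IsAlmostInvariant.of_closure hS fun s hs => ?_
    refine (hbd.union (hbd.mul_finite (Set.finite_singleton s⁻¹))).mono fun x hx => ?_
    by_cases hxC : x ∈ C
    · exact Or.inl ⟨hxC, s, hs, fun h => hx (iff_of_true hxC h)⟩
    · have hxs : x * s ∈ C := by_contra fun h => hx (iff_of_false hxC h)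
      exact Or.inr ⟨x * s, ⟨hxs, s⁻¹, hSinv s hs, by simpa using hxC⟩, s⁻¹, rfl,
        mul_inv_cancel_right x s⟩
  have hKH : K ≤ H := inf_le_right
  have hCaH : IsAlmostInvariant H C := fun s => (hCa s).of_le hKH
  set Y := cosetsInside H C with hYdef
  have hD : IsHFinite K {x | ¬ (x ∈ C ↔ x ∈ Y)} :=
    isHFinite_cosetsInside_symmDiff hmal heH hCaH hCH (fun k hk => hk.1) hT
      (hbd.mono fun x hx => ⟨hx.1, hx.2.imp fun t ht => ⟨Or.inr ht.1, ht.2⟩⟩)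
  have hKY : K ≤ MulAction.stabilizer G Y ⊓ H := by
    refine le_inf (fun k hk => ?_) hKH
    rw [MulAction.mem_stabilizer_iff, hYdef, smul_cosetsInside, show k • C = C from hk.1]
  refine exists_splitsOver_of_rightInvariant (Y := Y) heG (infinite_of_numEnds_subgroup heH) hmal
    rightInvariant_cosetsInside (disjoint_cosetsInside hCH) ?_ ?_
    (fun h hh => cosetsInside_eq_or_disjoint hmal heH hCaH hCH hCorb hh)
    (fun s => ((hCa.congr hD) s).of_le hKY)
  -- If `Y` were empty, `C` would be its own difference from `Y`, hence `H`-finite.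
  · by_contra hne
    rw [Set.not_nonempty_iff_eq_empty] at hne
    refine hc ((hD.of_le hKH).mono fun x hx => ?_)
    intro h
    exact absurd (h.1 hx) (by rw [hne]; exact Set.notMem_empty x)
  -- If `Y` and `H` covered `G`, then `Xᶜ`, which misses `C`, would lie in the union of `H` and the
  -- `K`-finite difference of `C` and `Y`.
  · by_contra! hout
    refine hXc (((hD.of_le hKH).union
      (IsHFinite.of_finite (Set.finite_singleton 1)).subgroup_mul).mono fun x hx => ?_)
    have hxC : x ∉ C := fun h => hx (hCX h)
    by_cases hxY : x ∈ Y
    · exact Or.inl fun h => hxC (h.2 hxY)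
    · exact Or.inr ⟨x, hout x hxY, 1, rfl, mul_one x⟩
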